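/- **Theorem 5.25 (Hecke's Prime Number Theorem for $\mathbb{Z}[i]$).** Call two elements of $\mathbb{Z}[i]$ associated if they differ by a factor $1,-1,i$ or $-i$, and for $\omega\in\mathbb{Z}[i]\setminus\{0\}$ let $\arg(\omega)\in[0,2\pi)$ be its argument as a complex number. For functions $f,g$ of a real variable with $g(x)\neq 0$ for all large $x$, write $f(x)\sim g(x)$ if $f(x)/g(x)\to1$ as $x\to\infty$. (a) For real $x$ let $\pi_i(x)$ be the number of prime elements $\mathfrak p$ of $\mathbb{Z}[i]$ with $|\mathfrak p|^2\le x$, counted up to associates; equivalently, $\pi_i(x)$ is the number of prime elements $\mathfrak p$ of $\mathbb{Z}[i]$ with $|\mathfrak p|^2\le x$ and $0\le\arg(\mathfrak p)<\pi/2$. Then $$\pi_i(x)\sim\frac{x}{\ln x}.$$ (b) For real numbers $\alpha,\beta$ with $0\le\alpha<\beta\le2\pi$ and real $x$, let $\pi_i(x;\alpha,\beta)$ be the number of all prime elements $\mathfrak p$ of $\mathbb{Z}[i]$ (associated primes being counted separately) with $|\mathfrak p|^2\le x$ and $\alpha\le\arg(\mathfrak p)<\beta$. Then $$\pi_i(x;\alpha,\beta)\sim\frac{2}{\pi}\,(\beta-\alpha)\,\frac{x}{\ln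 x}.$$ -/

import Mathlib

noncomputable section

namespace GaussianPNT

/-- The argument of a Gaussian integer, normalised to lie in `[0, 2π)`.
(For `ω = 0` the value is `0`; only arguments of primes matter below.) -/
def arg (ω : GaussianInt) : ℝ :=
  toIcoMod Real.two_pi_pos 0 (Complex.arg (GaussianInt.toComplex ω))

/-- The set `B_x(i)` of Gaussian integers `ω` with `|ω|² ≤ x`, where
`Zsqrtd.norm (a + b i) = a² + b²`. -/
def ball (x : ℝ) : Set GaussianInt :=
  {ω | ((Zsqrtd.norm ω : ℤ) : ℝ) ≤ x}

/-- The set of all prime elements of `ℤ[i]`. -/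
def primes : Set GaussianInt :=
  {p | Prime p}

/-- The prime elements of `ℤ[i]` in the first quadrant: `0 ≤ arg p < π/2`. -/
def primesPlus : Set GaussianInt :=
  {p | p ∈ primes ∧ 0 ≤ arg p ∧ arg p < Real.pi / 2}

/-- `π_i(x)`: the number of pairwise non-associated prime elements `p` with `|p|² ≤ x`, that is,
the number of classes of such primes up to multiplication by units. -/
def primeCount (x : ℝ) : ℕ :=
  (Associates.mk '' (primes ∩ ball x)).ncard

/-- `π_i(x; α, β)`: the number of all prime elements `p` with `|p|² ≤ x` and `α ≤ arg p < β`
(associated primes are counted separately). -/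
def sectorPrimeCount (α β x : ℝ) : ℕ :=
  {p | p ∈ primes ∩ ball x ∧ α ≤ arg p ∧ arg p < β}.ncard

/-- The sets counted above are finite, so `Set.ncard` is their true cardinality. -/
theorem ball_finite (x : ℝ) : (ball x).Finite := by
  have hinj : Set.InjOn (fun ω : GaussianInt => (ω.re, ω.im)) (ball x) := by
    intro a _ b _ h
    simp only [Prod.mk.injEq] at h
    exact Zsqrtd.ext h.1 h.2
  refine Set.Finite.of_finite_image ?_ hinj
  refine ((Set.finite_Icc (-⌈x⌉) ⌈x⌉).prod (Set.finite_Icc (-⌈x⌉) ⌈x⌉)).subset ?_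
  rintro _ ⟨ω, hω, rfl⟩
  have h : ω.norm ≤ ⌈x⌉ := by
    have h1 : ((Zsqrtd.norm ω : ℤ) : ℝ) ≤ (⌈x⌉ : ℝ) := le_trans hω (Int.le_ceil x)
    exact_mod_cast h1
  rw [Zsqrtd.norm_def] at h
  have hre : |ω.re| ≤ ω.re * ω.re := by
    rw [← abs_mul_abs_self]; rcases eq_or_ne ω.re 0 with h0 | h0
    · simp [h0]
    · nlinarith [Int.one_le_abs h0]
  have him : |ω.im| ≤ ω.im * ω.im := by
    rw [← abs_mul_abs_self]; rcases eq_or_ne ω.im 0 with h0 | h0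
    · simp [h0]
    · nlinarith [Int.one_le_abs h0]
  have h2 := mul_self_nonneg ω.re
  have h3 := mul_self_nonneg ω.im
  exact ⟨abs_le.1 (by linarith), abs_le.1 (by linarith)⟩

end GaussianPNT

end

/-! Weight each Gaussian prime `q` by `log N(q)` and consider, for every integer `n`, the sum of
`log N(q) * (q / |q|) ^ n` over `N(q) ≤ x`. If it is `4 x + o(x)` for `n = 0` and `o(x)` for all
other `n`, then Weyl's criterion (`tendsto_haarAddCircle_of_tendsto_fourier`) makes the weighted
arguments equidistribute on the circle. Arcs have null boundary, so the weighted sums over sectors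
follow, and `tendsto_card_mul_log_div` turns weighted sums into counts. The 4 counts the units. Part
(a) is the sector `[0, π/2)`, which meets every class of associates exactly once.

For `4 ∤ n` the sum vanishes: multiplication by `i` permutes the primes and multiplies the sum by `i
^ n ≠ 1`. For `4 ∣ n` one uses the series `heckeL n` of `χ_n(ω) N(ω)^{-s}` over all nonzero `ω`.
Continuation needs no functional equation: comparing the lattice sum of `χ_n` over a disc of radius
`R` with an integral leaves an error `O(R ^ (3/2))` (`norm_sum_angChar_sub_le`), so the Laplace
transform of the error is holomorphic for `Re s > 3/4`, and the only possible pole there is at `s =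
1`, for `n = 0`. The logarithmic derivative needs no Euler product: summing `∑_q v_q(ω) log N(q) = 4
log N(ω)` against `χ_n(ω) N(ω)^{-s}` in two orders gives `neg_four_mul_deriv_heckeL`. Nonvanishing
on `Re s ≥ 1` (`heckeG_ne_zero`) is the 3-4-1 argument, applied to the prime series itself. Finally
the Wiener–Ikehara theorem, proved by smoothing with the Fejér kernel, converts the boundary
behaviour into asymptotics. It requires nonnegative coefficients, so it is applied to the weights `1
+ Re (c χ_n)` and the case `c = 0` is subtracted. -/

noncomputable section

namespace HeckePNT

open MeasureTheory Set Filter Topology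

/-! ### The Fejér kernel -/

/-- The tent function of width `T`, the Fourier transform of the Fejér kernel. -/
def tent (T t : ℝ) : ℝ := max 0 (1 - |t| / T)

/-- The Fejér kernel `∫ tent T t * exp (i t v) dt`. -/
def fejer (T v : ℝ) : ℝ := T * Real.sinc (T * v / 2) ^ 2

lemma continuous_tent (T : ℝ) : Continuous (tent T) := by
  unfold tent; fun_prop

lemma tent_eq_zero {T t : ℝ} (hT : 0 < T) (ht : T ≤ |t|) : tent T t = 0 := by
  have : 1 ≤ |t| / T := by rwa [le_div_iff₀ hT, one_mul]
  exact max_eq_left (by linarith)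

lemma tent_eq {T t : ℝ} (hT : 0 < T) (ht : |t| ≤ T) : tent T t = 1 - |t| / T := by
  have : |t| / T ≤ 1 := by rwa [div_le_iff₀ hT, one_mul]
  exact max_eq_right (by linarith)

lemma hasCompactSupport_tent {T : ℝ} (hT : 0 < T) : HasCompactSupport (tent T) := by
  refine HasCompactSupport.intro (isCompact_Icc (a := -T) (b := T)) fun t ht => tent_eq_zero hT ?_
  by_contra! h
  exact ht (abs_le.1 h.le)

lemma integrable_tent {T : ℝ} (hT : 0 < T) : Integrable (tent T) :=
  (continuous_tent T).integrable_of_hasCompactSupport (hasCompactSupport_tent hT)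

lemma continuous_fejer (T : ℝ) : Continuous (fejer T) := by
  have := Real.continuous_sinc
  unfold fejer; fun_prop

lemma fejer_nonneg {T : ℝ} (hT : 0 < T) (v : ℝ) : 0 ≤ fejer T v := by
  unfold fejer; positivity

lemma sinc_sq_le (x : ℝ) : Real.sinc x ^ 2 ≤ 2 * (1 + x ^ 2)⁻¹ := by
  have h1 : Real.sinc x ^ 2 ≤ 1 := by
    rw [sq_le_one_iff_abs_le_one]; exact Real.abs_sinc_le_one x
  have h2 : x ^ 2 * Real.sinc x ^ 2 ≤ 1 := by
    rcases eq_or_ne x 0 with rfl | hx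
    · simp
    · rw [Real.sinc_of_ne_zero hx, div_pow, mul_div_cancel₀ _ (by positivity)]
      exact Real.sin_sq_le_one x
  rw [← div_eq_mul_inv, le_div_iff₀ (by positivity)]
  linarith

lemma integrable_sinc_sq : Integrable (fun x => Real.sinc x ^ 2) := by
  refine (integrable_inv_one_add_sq.const_mul 2).mono'
    (Real.continuous_sinc.pow 2).aestronglyMeasurable (Eventually.of_forall fun x => ?_)
  rw [Real.norm_of_nonneg (sq_nonneg _)]
  exact sinc_sq_le x

lemma fejer_eq_comp (T v : ℝ) : fejer T v = T * Real.sinc (T / 2 * v) ^ 2 := by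
  unfold fejer; ring_nf

lemma integrable_fejer {T : ℝ} (hT : 0 < T) : Integrable (fejer T) := by
  have := (integrable_sinc_sq.comp_mul_left' (R := T / 2) (by positivity)).const_mul T
  exact this.congr (Eventually.of_forall fun v => (fejer_eq_comp T v).symm)

/-- The total mass of the Fejér kernel, which does not depend on the width. -/
def fejerMass : ℝ := 2 * ∫ x, Real.sinc x ^ 2

lemma fejerMass_pos : 0 < fejerMass := by
  refine mul_pos two_pos ?_
  rw [integral_pos_iff_support_of_nonneg (fun x => sq_nonneg _) integrable_sinc_sq]
  refine (Real.continuous_sinc.pow 2).isOpen_support.measure_pos _ ⟨0, ?_⟩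
  simp

/-- Scaling. The value of the mass is never needed, only its positivity and its independence of `T`.
-/
lemma integral_fejer {T : ℝ} (hT : 0 < T) : ∫ v, fejer T v = fejerMass := by
  simp_rw [fejer_eq_comp, integral_const_mul]
  rw [Measure.integral_comp_mul_left (fun x => Real.sinc x ^ 2) (T / 2), fejerMass,
    abs_of_pos (by positivity), smul_eq_mul]
  field_simp

/-- The mass of the Fejér kernel concentrates near the origin as its width grows. -/
lemma tendsto_integral_fejer_Icc {δ : ℝ} (hδ : 0 < δ) :
    Tendsto (fun T => ∫ v in Icc (-δ) δ, fejer T v) atTop (𝓝 fejerMass) := by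
  have h1 : Tendsto (fun R : ℝ => 2 * ∫ x in Icc (-R) R, Real.sinc x ^ 2) atTop
      (𝓝 fejerMass) :=
    ((aecover_Icc (μ := volume) tendsto_neg_atTop_atBot tendsto_id)
      |>.integral_tendsto_of_countably_generated integrable_sinc_sq).const_mul 2
  have h2 : Tendsto (fun T : ℝ => T / 2 * δ) atTop atTop :=
    (tendsto_id.atTop_div_const two_pos).atTop_mul_const hδ
  refine (h1.comp h2).congr' ?_
  filter_upwards [eventually_gt_atTop 0] with T hT
  simp only [Function.comp]
  have hp : -(T / 2 * δ) ≤ T / 2 * δ := by nlinarith [mul_pos hT hδ]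
  rw [integral_Icc_eq_integral_Ioc, integral_Icc_eq_integral_Ioc,
    ← intervalIntegral.integral_of_le hp, ← intervalIntegral.integral_of_le (by linarith)]
  simp_rw [fejer_eq_comp, intervalIntegral.integral_const_mul]
  rw [intervalIntegral.integral_comp_mul_left (fun x => Real.sinc x ^ 2) (by positivity),
    smul_eq_mul, mul_neg]
  field_simp

lemma integral_one_sub_div_mul_exp {T : ℝ} (hT : 0 < T) {c : ℂ} (hc : c ≠ 0) :
    ∫ t in (0 : ℝ)..T, (1 - (t : ℂ) / T) * Complex.exp (c * t)
      = (Complex.exp (c * T) - 1) / (T * c ^ 2) - 1 / c := by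
  have hTc : (T : ℂ) ≠ 0 := by exact_mod_cast hT.ne'
  have hd : ∀ t : ℝ, HasDerivAt (fun t : ℝ => (1 - (t : ℂ) / T) * (Complex.exp (c * t) / c)
      + Complex.exp (c * t) / (T * c ^ 2)) ((1 - (t : ℂ) / T) * Complex.exp (c * t)) t := by
    intro t
    have h0 : HasDerivAt (fun t : ℝ => (t : ℂ)) 1 t := Complex.ofRealCLM.hasDerivAt
    have h1 : HasDerivAt (fun t : ℝ => Complex.exp (c * t)) (Complex.exp (c * t) * (c * 1)) t :=
      (h0.const_mul c).cexp
    have h2 := (((h0.div_const (T : ℂ)).const_sub 1).mul (h1.div_const c)).add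
      (h1.div_const (T * c ^ 2))
    refine h2.congr_deriv ?_
    field_simp
    ring
  rw [intervalIntegral.integral_eq_sub_of_hasDerivAt (fun t _ => hd t)
    (Continuous.intervalIntegrable (by fun_prop) _ _)]
  simp
  field_simp
  ring

/-- Splitting at 0 gives two half-tent integrals with `c = ∓ I v`; their `1 / c` terms cancel and `1
- cos (T v) = 2 sin² (T v / 2)` remains. The point `v = 0` is left out because the antiderivative
divides by `c`; a single point does not matter below. -/
lemma integral_tent_mul_exp {T : ℝ} (hT : 0 < T) {v : ℝ} (hv : v ≠ 0) :
    ∫ t : ℝ, (tent T t : ℂ) * Complex.exp (Complex.I * v * t) = fejer T v := by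
  have hTc : (T : ℂ) ≠ 0 := by exact_mod_cast hT.ne'
  have hvc : (v : ℂ) ≠ 0 := by exact_mod_cast hv
  set g : ℝ → ℂ := fun t => (tent T t : ℂ) * Complex.exp (Complex.I * v * t) with hg
  have hcont : Continuous g := by
    have := continuous_tent T
    fun_prop
  have h0 : ∫ t, g t = ∫ t in (-T)..T, g t := by
    rw [intervalIntegral.integral_of_le (by linarith), setIntegral_eq_integral_of_forall_compl_eq_zero]
    intro t ht
    have : T ≤ |t| := by
      by_contra! h
      exact ht ⟨(abs_lt.1 h).1, (abs_lt.1 h).2.le⟩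
    simp [hg, tent_eq_zero hT this]
  have hneg : ∫ t in (-T)..0, g t = ∫ t in (0 : ℝ)..T, g (-t) := by
    rw [intervalIntegral.integral_comp_neg (fun t => g t)]; simp
  rw [h0, ← intervalIntegral.integral_add_adjacent_intervals
    (hcont.intervalIntegrable (-T) 0) (hcont.intervalIntegrable 0 T), hneg]
  have e1 : ∫ t in (0 : ℝ)..T, g (-t)
      = ∫ t in (0 : ℝ)..T, (1 - (t : ℂ) / T) * Complex.exp (-(Complex.I * v) * t) := by
    refine intervalIntegral.integral_congr fun t ht => ?_
    rw [uIcc_of_le hT.le] at ht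
    simp only [hg]
    rw [tent_eq hT (by rw [abs_neg, abs_of_nonneg ht.1]; exact ht.2), abs_neg, abs_of_nonneg ht.1]
    push_cast; ring_nf
  have e2 : ∫ t in (0 : ℝ)..T, g t
      = ∫ t in (0 : ℝ)..T, (1 - (t : ℂ) / T) * Complex.exp ((Complex.I * v) * t) := by
    refine intervalIntegral.integral_congr fun t ht => ?_
    rw [uIcc_of_le hT.le] at ht
    simp only [hg]
    rw [tent_eq hT (by rw [abs_of_nonneg ht.1]; exact ht.2), abs_of_nonneg ht.1]
    push_cast; ring_nf
  have hI : Complex.I * (v : ℂ) ≠ 0 := mul_ne_zero Complex.I_ne_zero hvc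
  rw [e1, e2, integral_one_sub_div_mul_exp hT (neg_ne_zero.2 hI),
    integral_one_sub_div_mul_exp hT hI]
  have hs : fejer T v = 2 * (1 - Real.cos (T * v)) / (T * v ^ 2) := by
    rw [fejer, Real.sinc_of_ne_zero (by positivity)]
    have : Real.cos (T * v) = 1 - 2 * Real.sin (T * v / 2) ^ 2 := by
      rw [← Real.cos_sq_add_sin_sq (T * v / 2), show T * v = 2 * (T * v / 2) by ring,
        Real.cos_two_mul']; ring_nf
    rw [this]
    field_simp
    ring
  have hcos : Complex.cos (T * v) = (Complex.exp (Complex.I * v * T)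
      + Complex.exp (-(Complex.I * v) * T)) / 2 := by
    rw [Complex.cos]; ring_nf
  rw [hs]
  push_cast
  rw [hcos]
  have hI2 : Complex.I ^ 2 = -1 := Complex.I_sq
  field_simp
  rw [hI2]
  ring

/-! ### The Wiener–Ikehara theorem -/

section WienerIkehara

/-- Fubini: integrating the Laplace transform along the vertical line `Re s = ε` against a tent
amounts to smoothing `b u * exp (-ε u)` with the Fejér kernel centred at `y`. -/
lemma integral_tent_mul_laplace {b : ℝ → ℝ} {h : ℂ → ℂ} {T ε : ℝ} (hT : 0 < T)
    (hb : IntegrableOn (fun u => b u * Real.exp (-ε * u)) (Ioi 0))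
    (heq : ∀ t : ℝ, ∫ u in Ioi (0 : ℝ), (b u : ℂ) * Complex.exp (-(ε + Complex.I * t) * u)
      = h (ε + Complex.I * t)) (y : ℝ) :
    ∫ t : ℝ, (tent T t : ℂ) * h (ε + Complex.I * t) * Complex.exp (Complex.I * y * t)
      = ((∫ u in Ioi (0 : ℝ), b u * Real.exp (-ε * u) * fejer T (y - u) : ℝ) : ℂ) := by
  set Φ : ℝ → ℝ → ℂ := fun t u => (tent T t : ℂ) * ((b u * Real.exp (-ε * u) : ℝ) : ℂ)
    * Complex.exp (Complex.I * (y - u) * t) with hΦ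
  have hint : Integrable (Function.uncurry Φ) (volume.prod (volume.restrict (Ioi 0))) := by
    have h1 := (integrable_tent hT).ofReal (𝕜 := ℂ) |>.mul_prod hb.ofReal
    refine h1.mul_bdd (c := 1) ?_ (Eventually.of_forall fun p => ?_)
    · exact Continuous.aestronglyMeasurable (by fun_prop)
    · rw [Complex.norm_exp]
      simp
  have hL : ∀ t : ℝ, (tent T t : ℂ) * h (ε + Complex.I * t) * Complex.exp (Complex.I * y * t)
      = ∫ u in Ioi (0 : ℝ), Φ t u := by
    intro t
    rw [← heq t, mul_assoc, ← integral_mul_const, ← integral_const_mul]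
    refine integral_congr_ae (Eventually.of_forall fun u => ?_)
    simp only [hΦ]
    push_cast
    rw [mul_assoc, mul_assoc, mul_assoc, mul_assoc, ← Complex.exp_add, ← Complex.exp_add]
    ring_nf
  simp_rw [hL]
  rw [integral_integral_swap hint, ← integral_complex_ofReal]
  refine integral_congr_ae ?_
  -- The closed form of the kernel was proved away from `y - u = 0`, a null set.
  have hae : ∀ᵐ u ∂(volume.restrict (Ioi (0 : ℝ))), u ≠ y :=
    ae_restrict_of_ae (Measure.ae_ne volume y)
  filter_upwards [hae] with u hu
  have hv : y - u ≠ 0 := sub_ne_zero.2 hu.symm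
  have := integral_tent_mul_exp hT hv
  simp only [hΦ]
  push_cast at this ⊢
  rw [← this, ← integral_const_mul]
  congr 1 with t
  ring

variable {A : ℝ → ℝ} {h : ℂ → ℂ}

/-- Passage to the boundary line. The tent has compact support, so continuity of `h` up to the
boundary suffices and no growth bound in `t` is required. -/
lemma tendsto_integral_tent_mul (hc : ContinuousOn h {z | 0 ≤ z.re}) {T : ℝ} (hT : 0 < T) (y : ℝ) :
    Tendsto (fun n : ℕ => ∫ t : ℝ, (tent T t : ℂ)
        * h (((1 / (n + 1) : ℝ) : ℂ) + Complex.I * t) * Complex.exp (Complex.I * y * t)) atTop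
      (𝓝 (∫ t : ℝ, (tent T t : ℂ) * h (((0 : ℝ) : ℂ) + Complex.I * t)
        * Complex.exp (Complex.I * y * t))) := by
  have hcont : ContinuousOn (fun ε : ℝ => ∫ t : ℝ, (tent T t : ℂ)
      * h ((ε : ℂ) + Complex.I * t) * Complex.exp (Complex.I * y * t)) (Ici 0) := by
    refine continuousOn_integral_of_compact_support (isCompact_Icc (a := -T) (b := T)) ?_ ?_
    · have := continuous_tent T
      refine ContinuousOn.mul (ContinuousOn.mul ?_ ?_) ?_
      · exact Continuous.continuousOn (by fun_prop)
      · refine hc.comp (Continuous.continuousOn (by fun_prop)) ?_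
        rintro ⟨ε, t⟩ ⟨hε, -⟩
        simpa using hε
      · exact Continuous.continuousOn (by fun_prop)
    · intro ε t _ ht
      have : T ≤ |t| := by
        by_contra! h
        exact ht (abs_le.1 h.le)
      simp [tent_eq_zero hT this]
  have h0 := hcont 0 (mem_Ici.2 le_rfl)
  have := h0.tendsto.comp (tendsto_nhdsWithin_iff.2
    ⟨tendsto_one_div_add_atTop_nhds_zero_nat (𝕜 := ℝ), Eventually.of_forall fun n => ?_⟩)
  · simpa [Function.comp_def] using this
  · simp only [mem_Ici]; positivity

/-- The Riemann–Lebesgue lemma at frequency `-y / (2π)`. Any `g` is allowed: if the product is not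
integrable, every integral is 0 by convention. -/
lemma tendsto_integral_tent_atTop {T : ℝ} (g : ℝ → ℂ) :
    Tendsto (fun y : ℝ => ∫ t : ℝ, (tent T t : ℂ) * g t * Complex.exp (Complex.I * y * t)) atTop
      (𝓝 0) := by
  have h1 := Real.tendsto_integral_exp_smul_cocompact (fun t => (tent T t : ℂ) * g t)
  have h2 : Tendsto (fun y : ℝ => -(y / (2 * Real.pi))) atTop (cocompact ℝ) :=
    (tendsto_neg_atTop_atBot.comp (tendsto_id.atTop_div_const Real.two_pi_pos)).mono_right
      atBot_le_cocompact
  refine (h1.comp h2).congr fun y => ?_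
  simp only [Function.comp]
  congr 1 with t
  rw [Circle.smul_def, Real.fourierChar_apply, smul_eq_mul, mul_comm]
  congr 2
  push_cast
  have : (Real.pi : ℂ) ≠ 0 := by exact_mod_cast Real.pi_ne_zero
  field_simp

/-- The smoothed asymptotics: integrability of the smoothing and its limit. -/
lemma integrable_mul_fejer_and_tendsto (hnn : ∀ u, 0 ≤ A u)
    (hint : ∀ ε : ℝ, 0 < ε → IntegrableOn (fun u => A u * Real.exp (-ε * u)) (Ioi 0))
    (hc : ContinuousOn h {z | 0 ≤ z.re})
    (heq : ∀ z : ℂ, 0 < z.re →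
      ∫ u in Ioi (0 : ℝ), ((A u - 1 : ℝ) : ℂ) * Complex.exp (-z * u) = h z)
    {T : ℝ} (hT : 0 < T) :
    (∀ y, IntegrableOn (fun u => A u * fejer T (y - u)) (Ioi 0)) ∧
    Tendsto (fun y => ∫ u in Ioi (0 : ℝ), A u * fejer T (y - u)) atTop (𝓝 fejerMass) := by
  have hone : ∀ ε : ℝ, 0 < ε → IntegrableOn (fun u : ℝ => Real.exp (-ε * u)) (Ioi 0) :=
    fun ε hε => by simpa using exp_neg_integrableOn_Ioi 0 hε
  have hK : ∀ y, IntegrableOn (fun u => fejer T (y - u)) (Ioi 0) :=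
    fun y => ((integrable_fejer hT).comp_sub_left y).integrableOn
  have hKc : ∀ y, Continuous (fun u => fejer T (y - u)) := fun y =>
    (continuous_fejer T).comp (by fun_prop)
  have hbdd : ∃ C, ∀ v, |fejer T v| ≤ C := by
    refine ⟨T, fun v => ?_⟩
    rw [abs_of_nonneg (fejer_nonneg hT v), fejer]
    have : Real.sinc (T * v / 2) ^ 2 ≤ 1 := by
      rw [sq_le_one_iff_abs_le_one]; exact Real.abs_sinc_le_one _
    nlinarith
  obtain ⟨C, hC⟩ := hbdd
  have hmulK : ∀ y ε : ℝ, 0 < ε →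
      IntegrableOn (fun u => A u * Real.exp (-ε * u) * fejer T (y - u)) (Ioi 0) := fun y ε hε =>
    (hint ε hε).mul_bdd (c := C) (hKc y).aestronglyMeasurable
      (Eventually.of_forall fun u => hC _)
  have honeK : ∀ y ε : ℝ, 0 < ε →
      IntegrableOn (fun u => Real.exp (-ε * u) * fejer T (y - u)) (Ioi 0) := fun y ε hε =>
    (hone ε hε).mul_bdd (c := C) (hKc y).aestronglyMeasurable
      (Eventually.of_forall fun u => hC _)
  set e : ℕ → ℝ := fun n => 1 / ((n : ℝ) + 1) with he
  have hepos : ∀ n, 0 < e n := fun n => by simp only [he]; positivity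
  have helim : Tendsto e atTop (𝓝 0) := tendsto_one_div_add_atTop_nhds_zero_nat
  have hexp : ∀ u : ℝ, Tendsto (fun n => Real.exp (-e n * u)) atTop (𝓝 1) := fun u => by
    have : Tendsto (fun n => Real.exp (-e n * u)) atTop (𝓝 (Real.exp (-0 * u))) :=
      (Real.continuous_exp.tendsto _).comp (helim.neg.mul_const u)
    simpa using this
  set Ψ : ℝ → ℂ := fun y => ∫ t : ℝ, (tent T t : ℂ) * h (((0 : ℝ) : ℂ) + Complex.I * t)
    * Complex.exp (Complex.I * y * t) with hΨ
  -- the regularised identity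
  have hreg : ∀ y n, ((∫ u in Ioi (0 : ℝ), A u * Real.exp (-e n * u) * fejer T (y - u) : ℝ) : ℂ)
      = ((∫ u in Ioi (0 : ℝ), Real.exp (-e n * u) * fejer T (y - u) : ℝ) : ℂ)
        + ∫ t : ℝ, (tent T t : ℂ) * h ((e n : ℂ) + Complex.I * t)
          * Complex.exp (Complex.I * y * t) := by
    intro y n
    rw [integral_tent_mul_laplace (b := fun u => A u - 1) hT ?_ ?_ y, ← Complex.ofReal_add,
      ← integral_add (honeK y _ (hepos n)) ?_]
    · congr 2 with u; ring
    · refine ((hmulK y _ (hepos n)).sub (honeK y _ (hepos n))).congr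
        (Eventually.of_forall fun u => ?_)
      simp only [Pi.sub_apply]; ring
    · refine ((hint _ (hepos n)).sub (hone _ (hepos n))).congr (Eventually.of_forall fun u => ?_)
      simp only [Pi.sub_apply]; ring
    · intro t
      exact heq _ (by simpa using hepos n)
  have hlim1 : ∀ y, Tendsto (fun n => ∫ u in Ioi (0 : ℝ), Real.exp (-e n * u) * fejer T (y - u))
      atTop (𝓝 (∫ u in Ioi (0 : ℝ), fejer T (y - u))) := by
    intro y
    refine tendsto_integral_of_dominated_convergence (fun u => fejer T (y - u)) (fun n => ?_) (hK y)
      (fun n => ?_) (Eventually.of_forall fun u => ?_)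
    · exact (honeK y _ (hepos n)).aestronglyMeasurable
    · filter_upwards [ae_restrict_mem measurableSet_Ioi] with u hu
      rw [norm_mul, Real.norm_of_nonneg (Real.exp_pos _).le,
        Real.norm_of_nonneg (fejer_nonneg hT _)]
      refine mul_le_of_le_one_left (fejer_nonneg hT _) (Real.exp_le_one_iff.2 ?_)
      have := mul_pos (hepos n) (mem_Ioi.1 hu)
      linarith
    · simpa using (hexp u).mul_const (fejer T (y - u))
  have hlim2 : ∀ y, Tendsto
      (fun n => ∫ u in Ioi (0 : ℝ), A u * Real.exp (-e n * u) * fejer T (y - u))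
      atTop (𝓝 ((∫ u in Ioi (0 : ℝ), fejer T (y - u)) + (Ψ y).re)) := by
    intro y
    have h1 := tendsto_integral_tent_mul hc hT y
    have h2 := ((Complex.continuous_ofReal.tendsto _).comp (hlim1 y)).add h1
    have h3 := (Complex.continuous_re.tendsto _).comp h2
    simp only [Complex.add_re, Complex.ofReal_re] at h3
    refine h3.congr fun n => ?_
    simp only [Function.comp]
    rw [← hreg y n, Complex.ofReal_re]
  -- `A` is not yet known to be bounded, so nothing dominates at this point. Fatou's lemma and the
  -- finite limit `hlim2` give integrability; afterwards `A u * fejer T (y - u)` itself is the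
  -- dominating function.
  have hA : ∀ y, IntegrableOn (fun u => A u * fejer T (y - u)) (Ioi 0) := by
    intro y
    refine MeasureTheory.integrable_of_tendsto
      (G := fun n u => A u * Real.exp (-e n * u) * fejer T (y - u))
      (Eventually.of_forall fun u => ?_)
      (fun n => (hmulK y _ (hepos n)).aestronglyMeasurable) ?_
    · simpa using ((hexp u).const_mul (A u)).mul_const (fejer T (y - u))
    · have h1 : ∀ n, ∫⁻ u in Ioi (0 : ℝ), ‖A u * Real.exp (-e n * u) * fejer T (y - u)‖ₑ
          = ENNReal.ofReal (∫ u in Ioi (0 : ℝ), A u * Real.exp (-e n * u) * fejer T (y - u)) := by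
        intro n
        rw [ofReal_integral_eq_lintegral_ofReal (hmulK y _ (hepos n))
          (Eventually.of_forall fun u => mul_nonneg (mul_nonneg (hnn u) (Real.exp_pos _).le)
            (fejer_nonneg hT _))]
        refine lintegral_congr fun u => ?_
        rw [Real.enorm_eq_ofReal (mul_nonneg (mul_nonneg (hnn u) (Real.exp_pos _).le)
            (fejer_nonneg hT _))]
      simp_rw [h1]
      rw [(ENNReal.tendsto_ofReal (hlim2 y)).liminf_eq]
      exact ENNReal.ofReal_ne_top
  refine ⟨hA, ?_⟩
  have hval : ∀ y, ∫ u in Ioi (0 : ℝ), A u * fejer T (y - u)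
      = (∫ u in Ioi (0 : ℝ), fejer T (y - u)) + (Ψ y).re := by
    intro y
    refine tendsto_nhds_unique (tendsto_integral_of_dominated_convergence
      (fun u => A u * fejer T (y - u)) (fun n => ?_) (hA y)
      (fun n => ?_) (Eventually.of_forall fun u => ?_)) (hlim2 y)
    · exact (hmulK y _ (hepos n)).aestronglyMeasurable
    · filter_upwards [ae_restrict_mem measurableSet_Ioi] with u hu
      rw [norm_mul, norm_mul, Real.norm_of_nonneg (Real.exp_pos _).le,
        Real.norm_of_nonneg (fejer_nonneg hT _), Real.norm_of_nonneg (hnn u)]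
      refine mul_le_mul_of_nonneg_right (mul_le_of_le_one_right (hnn u)
        (Real.exp_le_one_iff.2 ?_)) (fejer_nonneg hT _)
      have := mul_pos (hepos n) (mem_Ioi.1 hu)
      linarith
    · simpa using ((hexp u).const_mul (A u)).mul_const (fejer T (y - u))
  simp_rw [hval]
  -- The boundary integral dies by Riemann–Lebesgue, while the kernel on `u > 0`, reflected to `v <
  -- y`, exhausts the full mass.
  rw [show fejerMass = fejerMass + (0 : ℂ).re by simp]
  refine Tendsto.add ?_ ((Complex.continuous_re.tendsto _).comp
    (tendsto_integral_tent_atTop (fun t => h (((0 : ℝ) : ℂ) + Complex.I * t))))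
  have h1 : Tendsto (fun y => ∫ v in Iio y, fejer T v) atTop (𝓝 (∫ v, fejer T v)) :=
    (aecover_Iio (μ := volume) tendsto_id).integral_tendsto_of_countably_generated
      (integrable_fejer hT)
  rw [integral_fejer hT] at h1
  refine h1.congr fun y => ?_
  rw [← integral_indicator measurableSet_Iio, ← integral_indicator measurableSet_Ioi,
    ← integral_sub_left_eq_self _ volume y]
  congr 1 with u
  simp [indicator]

/-- **Wiener–Ikehara theorem**, in Laplace transform form: if `S` is nonnegative and monotone and
the Laplace transform of `S u * exp (-u) - 1` extends continuously to the closed right half plane,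
then `S u ~ exp u`. -/
theorem wiener_ikehara {S : ℝ → ℝ} (hmono : Monotone S) (hnn : ∀ u, 0 ≤ S u)
    (hint : ∀ ε : ℝ, 0 < ε → IntegrableOn (fun u => S u * Real.exp (-u) * Real.exp (-ε * u)) (Ioi 0))
    (hc : ContinuousOn h {z | 0 ≤ z.re})
    (heq : ∀ z : ℂ, 0 < z.re →
      ∫ u in Ioi (0 : ℝ), ((S u * Real.exp (-u) - 1 : ℝ) : ℂ) * Complex.exp (-z * u) = h z) :
    Tendsto (fun u => S u * Real.exp (-u)) atTop (𝓝 1) := by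
  set B : ℝ → ℝ := fun u => S u * Real.exp (-u) with hB
  have hBnn : ∀ u, 0 ≤ B u := fun u => mul_nonneg (hnn u) (Real.exp_pos _).le
  have key := fun T (hT : (0 : ℝ) < T) => integrable_mul_fejer_and_tendsto hBnn hint hc heq hT
  have hIpos := fejerMass_pos
  have hKi : ∀ T y (s : Set ℝ), 0 < T → IntegrableOn (fun u => fejer T (y - u)) s :=
    fun T y s hT => ((integrable_fejer hT).comp_sub_left y).integrableOn
  -- `B` varies slowly
  have hslow : ∀ u v, u ≤ v → B u * Real.exp (-(v - u)) ≤ B v := by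
    intro u v huv
    simp only [hB]
    rw [mul_assoc, ← Real.exp_add, show -u + -(v - u) = -v by ring]
    exact mul_le_mul_of_nonneg_right (hmono huv) (Real.exp_pos _).le
  have hwin : ∀ T δ y : ℝ, 0 < δ → ∫ u in Icc (y - δ) (y + δ), fejer T (y - u)
      = ∫ v in Icc (-δ) δ, fejer T v := by
    intro T δ y hδ
    rw [integral_Icc_eq_integral_Ioc, integral_Icc_eq_integral_Ioc,
      ← intervalIntegral.integral_of_le (by linarith),
      ← intervalIntegral.integral_of_le (by linarith),
      intervalIntegral.integral_comp_sub_left (fun v => fejer T v)]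
    ring_nf
  -- Centring the kernel at `y + δ` places the window `[y, y + 2δ]` to the right of `y`, where `B`
  -- is at least `exp (-2δ) * B y`.
  have hupper : ∀ δ T : ℝ, 0 < δ → 0 < T → ∀ y, 0 < y →
      B y * (Real.exp (-(2 * δ)) * ∫ v in Icc (-δ) δ, fejer T v)
        ≤ ∫ u in Ioi (0 : ℝ), B u * fejer T (y + δ - u) := by
    intro δ T hδ hT y hy
    have hsub : Icc (y + δ - δ) (y + δ + δ) ⊆ Ioi (0 : ℝ) := fun u hu =>
      mem_Ioi.2 (by linarith [hu.1])
    rw [← hwin T δ (y + δ) hδ, ← mul_assoc, ← integral_const_mul]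
    refine le_trans (setIntegral_mono_on ((hKi T _ _ hT).const_mul _)
      (((key T hT).1 (y + δ)).mono_set hsub) measurableSet_Icc fun u hu => ?_)
      (setIntegral_mono_set ((key T hT).1 (y + δ)) (Eventually.of_forall fun u =>
        mul_nonneg (hBnn u) (fejer_nonneg hT _)) (Eventually.of_forall hsub))
    refine mul_le_mul_of_nonneg_right (le_trans ?_ (hslow y u (by linarith [hu.1])))
      (fejer_nonneg hT _)
    refine mul_le_mul_of_nonneg_left (Real.exp_le_exp.2 ?_) (hBnn y)
    linarith [hu.2]
  have hup : ∀ b : ℝ, 1 < b → ∀ᶠ y in atTop, B y < b := by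
    intro b hb
    obtain ⟨δ, hδ, hδb⟩ : ∃ δ : ℝ, 0 < δ ∧ 1 < b * Real.exp (-(2 * δ)) := by
      have hcont : Tendsto (fun δ : ℝ => b * Real.exp (-(2 * δ))) (𝓝[>] 0)
          (𝓝 (b * Real.exp (-(2 * 0)))) := by
        refine Tendsto.mono_left (Continuous.tendsto ?_ 0) nhdsWithin_le_nhds
        fun_prop
      have h1 := hcont.eventually_const_lt (u := 1) (by simpa using hb)
      obtain ⟨δ, h2, h3⟩ := (h1.and self_mem_nhdsWithin).exists
      exact ⟨δ, h3, h2⟩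
    have hT1 : ∀ᶠ T in atTop, fejerMass < b * Real.exp (-(2 * δ)) * ∫ v in Icc (-δ) δ, fejer T v :=
      ((tendsto_integral_fejer_Icc hδ).const_mul (b * Real.exp (-(2 * δ)))).eventually_const_lt
        (by nlinarith)
    obtain ⟨T, hTb, hT⟩ := (hT1.and (eventually_gt_atTop 0)).exists
    have hshift : Tendsto (fun y : ℝ => y + δ) atTop atTop := tendsto_atTop_add_const_right _ _ tendsto_id
    have hlim := ((key T hT).2.comp hshift).eventually_lt_const hTb
    filter_upwards [hlim, eventually_gt_atTop 0] with y hy hy0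
    have h1 := (hupper δ T hδ hT y hy0).trans_lt hy
    have hc0 : 0 < Real.exp (-(2 * δ)) * ∫ v in Icc (-δ) δ, fejer T v := by
      by_contra! hle
      have : b * Real.exp (-(2 * δ)) * ∫ v in Icc (-δ) δ, fejer T v ≤ 0 := by
        rw [mul_assoc]; exact mul_nonpos_of_nonneg_of_nonpos (by linarith) hle
      linarith
    rw [mul_assoc b] at h1
    exact lt_of_mul_lt_mul_right h1 hc0.le
  -- Beyond `Y` the upper bound just proved gives `B < 2`; before `Y`, monotonicity gives `B u ≤ S u
  -- ≤ S Y`.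
  obtain ⟨M, hM0, hM⟩ : ∃ M, 0 < M ∧ ∀ u, 0 < u → B u ≤ M := by
    obtain ⟨Y, hY⟩ := eventually_atTop.1 (hup 2 (by norm_num))
    refine ⟨max 2 (S Y), lt_max_of_lt_left two_pos, fun u hu => ?_⟩
    rcases le_total Y u with h1 | h1
    · exact (hY u h1).le.trans (le_max_left _ _)
    · refine le_trans ?_ (le_max_right _ _)
      calc B u ≤ S u * 1 := mul_le_mul_of_nonneg_left
            (Real.exp_le_one_iff.2 (by linarith)) (hnn u)
        _ ≤ S Y := by simpa using hmono h1
  -- Now the window `[y - 2δ, y]` lies to the left of `y`, where `B` is at most `exp (2δ) * B y`;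
  -- outside it, `B ≤ M` and only the small tail mass of the kernel counts.
  have hlower : ∀ δ T : ℝ, 0 < δ → 0 < T → ∀ y, 2 * δ < y →
      (∫ u in Ioi (0 : ℝ), B u * fejer T (y - δ - u))
        ≤ B y * Real.exp (2 * δ) * fejerMass
          + M * (fejerMass - ∫ v in Icc (-δ) δ, fejer T v) := by
    intro δ T hδ hT y hy
    set W : Set ℝ := Icc (y - δ - δ) (y - δ + δ) with hW
    have hsub : W ⊆ Ioi (0 : ℝ) := fun u hu => mem_Ioi.2 (by linarith [hu.1])
    have hKtot : ∫ u, fejer T (y - δ - u) = fejerMass := by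
      rw [integral_sub_left_eq_self (fun u => fejer T u), integral_fejer hT]
    have hKW := hwin T δ (y - δ) hδ
    rw [← integral_inter_add_sdiff measurableSet_Icc ((key T hT).1 (y - δ)) (t := W),
      inter_eq_self_of_subset_right hsub]
    refine add_le_add ?_ ?_
    · calc ∫ u in W, B u * fejer T (y - δ - u)
          ≤ ∫ u in W, (B y * Real.exp (2 * δ)) * fejer T (y - δ - u) := by
            refine setIntegral_mono_on (((key T hT).1 (y - δ)).mono_set hsub)
              ((hKi T _ _ hT).const_mul _) measurableSet_Icc fun u hu => ?_
            refine mul_le_mul_of_nonneg_right ?_ (fejer_nonneg hT _)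
            have h1 := hslow u y (by linarith [hu.2])
            have h2 : B u = B u * Real.exp (-(y - u)) * Real.exp (y - u) := by
              rw [mul_assoc, ← Real.exp_add]; simp
            rw [h2]
            exact mul_le_mul h1 (Real.exp_le_exp.2 (by linarith [hu.1])) (Real.exp_pos _).le
              (hBnn y)
        _ = (B y * Real.exp (2 * δ)) * ∫ u in W, fejer T (y - δ - u) := integral_const_mul _ _
        _ ≤ B y * Real.exp (2 * δ) * fejerMass := by
            refine mul_le_mul_of_nonneg_left ?_ (mul_nonneg (hBnn y) (Real.exp_pos _).le)
            rw [← hKtot]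
            exact setIntegral_le_integral ((integrable_fejer hT).comp_sub_left _)
              (Eventually.of_forall fun u => fejer_nonneg hT _)
    · calc ∫ u in Ioi 0 \ W, B u * fejer T (y - δ - u)
          ≤ ∫ u in Ioi 0 \ W, M * fejer T (y - δ - u) := by
            refine setIntegral_mono_on (((key T hT).1 (y - δ)).mono_set sdiff_subset)
              ((hKi T _ _ hT).const_mul _) (measurableSet_Ioi.diff measurableSet_Icc) fun u hu => ?_
            exact mul_le_mul_of_nonneg_right (hM u hu.1) (fejer_nonneg hT _)
        _ = M * ∫ u in Ioi 0 \ W, fejer T (y - δ - u) := integral_const_mul _ _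
        _ ≤ M * (fejerMass - ∫ v in Icc (-δ) δ, fejer T v) := by
            refine mul_le_mul_of_nonneg_left ?_ hM0.le
            rw [← hKW, ← hKtot, ← setIntegral_compl measurableSet_Icc
              ((integrable_fejer hT).comp_sub_left _)]
            exact setIntegral_mono_set (hKi T _ _ hT)
              (Eventually.of_forall fun u => fejer_nonneg hT _)
              (Eventually.of_forall fun u hu => hu.2)
  refine tendsto_order.2 ⟨fun a ha => ?_, hup⟩
  obtain ⟨δ, hδ, hδa⟩ : ∃ δ : ℝ, 0 < δ ∧ a * Real.exp (2 * δ) < 1 := by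
    have hcont : Tendsto (fun δ : ℝ => a * Real.exp (2 * δ)) (𝓝[>] 0)
        (𝓝 (a * Real.exp (2 * 0))) := by
      refine Tendsto.mono_left (Continuous.tendsto ?_ 0) nhdsWithin_le_nhds
      fun_prop
    obtain ⟨δ, h2, h3⟩ :=
      ((hcont.eventually_lt_const (u := 1) (by simpa using ha)).and self_mem_nhdsWithin).exists
    exact ⟨δ, h3, h2⟩
  have hT1 : ∀ᶠ T in atTop, a * Real.exp (2 * δ) * fejerMass
      + M * (fejerMass - ∫ v in Icc (-δ) δ, fejer T v) < fejerMass := by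
    have := (((tendsto_integral_fejer_Icc hδ).const_sub fejerMass).const_mul M).const_add
      (a * Real.exp (2 * δ) * fejerMass)
    refine this.eventually_lt_const ?_
    nlinarith
  obtain ⟨T, hTb, hT⟩ := (hT1.and (eventually_gt_atTop 0)).exists
  have hshift : Tendsto (fun y : ℝ => y - δ) atTop atTop :=
    tendsto_atTop_add_const_right _ (-δ) tendsto_id
  have hlim := ((key T hT).2.comp hshift).eventually_const_lt hTb
  filter_upwards [hlim, eventually_gt_atTop (2 * δ)] with y hy hy0
  have h1 := hy.trans_le (hlower δ T hδ hT y hy0)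
  have h2 : a * (Real.exp (2 * δ) * fejerMass) < B y * (Real.exp (2 * δ) * fejerMass) := by
    linarith
  exact lt_of_mul_lt_mul_right h2 (mul_pos (Real.exp_pos _) hIpos).le

end WienerIkehara

/-! ### Generalised Dirichlet series as Laplace transforms -/

/-- Tonelli for the norms. The termwise integration formula does not by itself say that the sum is
integrable. -/
lemma integrable_tsum_of_summable_integral_norm {α ι : Type*} [Countable ι] [MeasurableSpace α]
    {μ : Measure α} {F : ι → α → ℂ} (hF_int : ∀ i : ι, Integrable (F i) μ)
    (hF_meas : ∀ i, Measurable (F i))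
    (hF_sum : Summable fun i ↦ ∫ a, ‖F i a‖ ∂μ) : Integrable (fun a => ∑' i, F i a) μ := by
  refine ⟨(Measurable.tsum hF_meas).aestronglyMeasurable, ?_⟩
  have h1 : ∀ a, ‖∑' i, F i a‖ₑ ≤ ∑' i, ‖F i a‖ₑ := fun a => enorm_tsum_le_tsum_enorm
  refine (lintegral_mono h1).trans_lt ?_
  rw [lintegral_tsum fun i => (hF_meas i).enorm.aemeasurable]
  have h2 : ∀ i, ∫⁻ a, ‖F i a‖ₑ ∂μ = ENNReal.ofReal (∫ a, ‖F i a‖ ∂μ) := fun i =>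
    (ofReal_integral_norm_eq_lintegral_enorm (hF_int i)).symm
  simp_rw [h2]
  exact hF_sum.tsum_ofReal_lt_top

/-- The summatory function `∑_{ℓ i ≤ u} w i`. -/
def summatory {ι E : Type*} [AddCommMonoid E] [TopologicalSpace E] (w : ι → E) (ℓ : ι → ℝ)
    (u : ℝ) : E :=
  ∑' i, if ℓ i ≤ u then w i else 0

lemma integrableOn_cexp_neg_mul {s : ℂ} (hs : 0 < s.re) (a : ℝ) :
    IntegrableOn (fun u : ℝ => Complex.exp (-s * u)) (Ioi a) :=
  integrableOn_exp_mul_complex_Ioi (by simpa using hs) a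

lemma measurable_summatory {ι : Type*} [Countable ι] (w : ι → ℂ) (ℓ : ι → ℝ) :
    Measurable (summatory w ℓ) := by
  unfold summatory
  exact Measurable.tsum fun i => Measurable.ite measurableSet_Ici measurable_const measurable_const

/-- Partial summation: each `exp (-s ℓ)` is `s` times the integral of `exp (-s u)` over `u > ℓ`, and
absolute convergence lets sum and integral be exchanged. -/
lemma laplace_summatory {ι : Type*} [Countable ι] {w : ι → ℂ} {ℓ : ι → ℝ} (hℓ : ∀ i, 0 ≤ ℓ i)
    {s : ℂ} (hs : 0 < s.re) (hsum : Summable fun i => ‖w i‖ * Real.exp (-s.re * ℓ i)) :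
    IntegrableOn (fun u => summatory w ℓ u * Complex.exp (-s * u)) (Ioi 0) ∧
    ∑' i, w i * Complex.exp (-s * ℓ i)
      = s * ∫ u in Ioi (0 : ℝ), summatory w ℓ u * Complex.exp (-s * u) := by
  have hs0 : s ≠ 0 := by rintro rfl; simp at hs
  set F : ι → ℝ → ℂ := fun i => (Ici (ℓ i)).indicator fun u => w i * Complex.exp (-s * u) with hF
  have hFeq : ∀ u, ∑' i, F i u = summatory w ℓ u * Complex.exp (-s * u) := by
    intro u
    rw [summatory, ← tsum_mul_right]
    congr 1 with i
    by_cases h : ℓ i ≤ u <;> simp [hF, h]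
  have hmeas : ∀ i, Measurable (F i) := fun i =>
    Measurable.indicator (by fun_prop) measurableSet_Ici
  have hexp : ∀ i, IntegrableOn (fun u : ℝ => w i * Complex.exp (-s * u)) (Ici (ℓ i)) := fun i =>
    ((integrableOn_Ici_iff_integrableOn_Ioi (by finiteness)).2
      (integrableOn_cexp_neg_mul hs _)).const_mul _
  have hint : ∀ i, IntegrableOn (F i) (Ioi 0) := fun i =>
    ((integrable_indicator_iff measurableSet_Ici).2 (hexp i)).integrableOn
  have hae : ∀ i, (Ioi 0 ∩ Ici (ℓ i) : Set ℝ) =ᵐ[volume] Ioi (ℓ i) := by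
    intro i
    have h1 : (Ioi 0 ∩ Ici (ℓ i) : Set ℝ) =ᵐ[volume] (Ioi 0 ∩ Ioi (ℓ i) : Set ℝ) :=
      (ae_eq_refl _).inter Ioi_ae_eq_Ici.symm
    rwa [Ioi_inter_Ioi, sup_eq_right.2 (hℓ i)] at h1
  have hval : ∀ i, ∫ u in Ioi 0, F i u = w i * Complex.exp (-s * ℓ i) / s := by
    intro i
    rw [setIntegral_indicator measurableSet_Ici, setIntegral_congr_set (hae i), integral_const_mul,
      integral_exp_mul_complex_Ioi (by simpa using hs)]
    field_simp
  have hnorm : ∀ i, ∫ u in Ioi 0, ‖F i u‖ = ‖w i‖ * Real.exp (-s.re * ℓ i) / s.re := by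
    intro i
    have : ∀ u, ‖F i u‖ = (Ici (ℓ i)).indicator (fun u => ‖w i‖ * Real.exp (-s.re * u)) u := by
      intro u
      rw [hF, norm_indicator_eq_indicator_norm]
      congr 1 with u
      rw [norm_mul, Complex.norm_exp]
      simp
    simp_rw [this]
    rw [setIntegral_indicator measurableSet_Ici, setIntegral_congr_set (hae i), integral_const_mul,
      integral_exp_mul_Ioi (by linarith)]
    field_simp
  have hsummable : Summable fun i => ∫ u in Ioi 0, ‖F i u‖ := by
    simp_rw [hnorm]
    exact hsum.div_const _
  refine ⟨?_, ?_⟩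
  · have := integrable_tsum_of_summable_integral_norm hint hmeas hsummable
    simp only [hFeq] at this
    exact this
  · have := integral_tsum_of_summable_integral_norm hint hsummable
    simp_rw [hFeq, hval, tsum_div_const] at this
    rw [← this]
    field_simp

lemma differentiableOn_laplace {f : ℝ → ℂ} (hf : Measurable f) {C θ : ℝ}
    (hb : ∀ u, 0 < u → ‖f u‖ ≤ C * Real.exp (θ * u)) :
    DifferentiableOn ℂ (fun s => ∫ u in Ioi (0 : ℝ), f u * Complex.exp (-s * u))
      {s | θ < s.re} := by
  intro s₀ hs₀
  have hC : 0 ≤ C := nonneg_of_mul_nonneg_left ((norm_nonneg _).trans (hb 1 one_pos)) (Real.exp_pos _)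
  -- A ball of radius `δ` leaves decay `exp (-δ u)`; half of it absorbs the factor `u` produced by
  -- differentiation.
  obtain ⟨δ, hδ, hδs⟩ : ∃ δ, 0 < δ ∧ s₀.re = θ + 2 * δ :=
    ⟨(s₀.re - θ) / 2, by linarith [mem_ofPred.1 hs₀], by ring⟩
  have hre : ∀ s ∈ Metric.ball s₀ δ, θ + δ ≤ s.re := by
    intro s hs
    rw [Metric.mem_ball, dist_eq_norm] at hs
    have := (Complex.abs_re_le_norm (s - s₀)).trans hs.le
    rw [Complex.sub_re, abs_le] at this
    linarith [this.1]
  have hnexp : ∀ s ∈ Metric.ball s₀ δ, ∀ u : ℝ, 0 < u →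
      ‖f u * Complex.exp (-s * u)‖ ≤ C * Real.exp (-δ * u) := by
    intro s hs u hu
    rw [norm_mul, Complex.norm_exp]
    have h1 : (-s * (u : ℂ)).re = -s.re * u := by simp
    rw [h1]
    calc ‖f u‖ * Real.exp (-s.re * u)
        ≤ (C * Real.exp (θ * u)) * Real.exp (-(θ + δ) * u) := by
          refine mul_le_mul (hb u hu) (Real.exp_le_exp.2 ?_) (Real.exp_pos _).le (by positivity)
          nlinarith [hre s hs]
      _ = C * Real.exp (-δ * u) := by
          rw [mul_assoc, ← Real.exp_add]; ring_nf
  have hmeas : ∀ s : ℂ, Measurable fun u : ℝ => f u * Complex.exp (-s * u) := fun s =>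
    hf.mul (by fun_prop)
  have key := hasDerivAt_integral_of_dominated_loc_of_deriv_le (μ := volume.restrict (Ioi (0 : ℝ)))
    (F := fun s u => f u * Complex.exp (-s * u))
    (F' := fun s u => -(u : ℂ) * (f u * Complex.exp (-s * u)))
    (bound := fun u => (2 / δ) * C * Real.exp (-(δ / 2) * u)) (x₀ := s₀)
    (Metric.ball_mem_nhds s₀ hδ) (Eventually.of_forall fun s => (hmeas s).aestronglyMeasurable)
    ?_ ?_ ?_ ?_ ?_
  · exact key.2.differentiableAt.differentiableWithinAt
  · refine Integrable.mono' (g := fun u => C * Real.exp (-δ * u))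
      ((exp_neg_integrableOn_Ioi 0 hδ).const_mul C) (hmeas s₀).aestronglyMeasurable ?_
    filter_upwards [ae_restrict_mem measurableSet_Ioi] with u hu
    exact hnexp s₀ (Metric.mem_ball_self hδ) u hu
  · exact (Measurable.mul (by fun_prop) (hmeas s₀)).aestronglyMeasurable
  · filter_upwards [ae_restrict_mem measurableSet_Ioi] with u hu s hs
    rw [norm_mul, norm_neg, Complex.norm_real, Real.norm_of_nonneg (le_of_lt hu)]
    have h1 : u ≤ 2 / δ * Real.exp (δ / 2 * u) := by
      have := Real.add_one_le_exp (δ / 2 * u)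
      rw [div_mul_eq_mul_div, le_div_iff₀ hδ]
      linarith
    calc u * ‖f u * Complex.exp (-s * u)‖
        ≤ (2 / δ * Real.exp (δ / 2 * u)) * (C * Real.exp (-δ * u)) :=
          mul_le_mul h1 (hnexp s hs u hu) (norm_nonneg _) (by positivity)
      _ = 2 / δ * C * (Real.exp (δ / 2 * u) * Real.exp (-δ * u)) := by ring
      _ = 2 / δ * C * Real.exp (-(δ / 2) * u) := by
          rw [← Real.exp_add]; ring_nf
  · exact (exp_neg_integrableOn_Ioi 0 (half_pos hδ)).const_mul _
  · refine Eventually.of_forall fun u s _ => ?_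
    have h1 : HasDerivAt (fun s : ℂ => Complex.exp (-s * u)) (Complex.exp (-s * u) * (-1 * u)) s :=
      ((hasDerivAt_id s).neg.mul_const (u : ℂ)).cexp
    refine (h1.const_mul (f u)).congr_deriv ?_
    ring

/-- **Wiener–Ikehara theorem** for generalised Dirichlet series with nonnegative coefficients. -/
theorem tendsto_summatory_mul_exp_neg {ι : Type*} [Countable ι] {w : ι → ℝ} {ℓ : ι → ℝ}
    (hw : ∀ i, 0 ≤ w i) (hℓ : ∀ i, 0 ≤ ℓ i)
    (hsum : ∀ σ : ℝ, 1 < σ → Summable fun i => w i * Real.exp (-σ * ℓ i)) {c : ℝ} (hc : 0 < c)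
    {R : ℂ → ℂ} (hR : ContinuousOn R {s | 1 ≤ s.re})
    (heq : ∀ s : ℂ, 1 < s.re → ∑' i, (w i : ℂ) * Complex.exp (-s * ℓ i) = c / (s - 1) + R s) :
    Tendsto (fun u => summatory w ℓ u * Real.exp (-u)) atTop (𝓝 c) := by
  -- Rankin's trick at `σ = 2`: the condition `ℓ i ≤ u` is bounded by `exp (2 (u - ℓ i))`.
  have hsw : ∀ u, Summable fun i => if ℓ i ≤ u then w i else 0 := by
    intro u
    refine Summable.of_nonneg_of_le (fun i => ?_) (fun i => ?_)
      ((hsum 2 one_lt_two).mul_left (Real.exp (2 * u)))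
    · split_ifs <;> simp [hw]
    · split_ifs with h
      · rw [mul_left_comm, ← Real.exp_add]
        exact le_mul_of_one_le_right (hw i) (Real.one_le_exp (by linarith))
      · have := hw i
        positivity
  have hcast : ∀ u, ((summatory w ℓ u : ℝ) : ℂ) = summatory (fun i => (w i : ℂ)) ℓ u := by
    intro u
    simp only [summatory]
    rw [Complex.ofReal_tsum]
    congr 1 with i
    split_ifs <;> simp
  have hcc : (c : ℂ) ≠ 0 := by exact_mod_cast hc.ne'
  have hlap := fun (s : ℂ) (hs : 1 < s.re) => laplace_summatory (w := fun i => (w i : ℂ)) hℓ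
    (s := s) (by linarith) (by simpa [abs_of_nonneg (hw _)] using hsum s.re hs)
  have hint : ∀ s : ℂ, 1 < s.re → IntegrableOn
      (fun u : ℝ => ((summatory w ℓ u : ℝ) : ℂ) * Complex.exp (-s * u)) (Ioi 0) := by
    intro s hs
    simpa only [hcast] using (hlap s hs).1
  have hval : ∀ s : ℂ, 1 < s.re →
      ∫ u in Ioi (0 : ℝ), ((summatory w ℓ u : ℝ) : ℂ) * Complex.exp (-s * u)
        = (c / (s - 1) + R s) / s := by
    intro s hs
    have hs0 : s ≠ 0 := by rintro rfl; simp at hs; linarith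
    rw [← heq s hs, (hlap s hs).2, mul_div_cancel_left₀ _ hs0]
    simp only [hcast]
  -- With `s = 1 + z` the pole cancels exactly: `(c / z + R) / (c (1 + z)) - 1 / z = (R / c - 1) /
  -- (1 + z)`.
  have key := wiener_ikehara (S := fun u => summatory w ℓ u / c)
    (h := fun z => (R (1 + z) / c - 1) / (1 + z)) ?_ ?_ ?_ ?_ ?_
  · have := key.const_mul c
    rw [mul_one] at this
    refine this.congr fun u => ?_
    field_simp
  · intro u v huv
    refine div_le_div_of_nonneg_right ?_ hc.le
    refine (hsw u).tsum_le_tsum (fun i => ?_) (hsw v)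
    by_cases h : ℓ i ≤ u
    · simp [h, h.trans huv]
    · simp only [h, if_false]
      split_ifs <;> simp [hw]
  · intro u
    refine div_nonneg (tsum_nonneg fun i => ?_) hc.le
    split_ifs <;> simp [hw]
  · intro ε hε
    have h1 := ((hint (1 + ε : ℝ) (by simpa using hε)).re).div_const c
    refine IntegrableOn.congr_fun h1 (fun u _ => ?_) measurableSet_Ioi
    have h2 : Complex.exp (-((1 + ε : ℝ) : ℂ) * u) = ((Real.exp (-(1 + ε) * u) : ℝ) : ℂ) := by
      push_cast; rfl
    simp only [h2, ← Complex.ofReal_mul, RCLike.re_to_complex, Complex.ofReal_re]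
    rw [mul_assoc, ← Real.exp_add]
    ring_nf
  · have h1 : MapsTo (fun z : ℂ => 1 + z) {z | 0 ≤ z.re} {s | 1 ≤ s.re} := fun z hz => by
      simpa using hz
    refine ContinuousOn.div (((hR.comp (by fun_prop) h1).div_const _).sub continuousOn_const)
      (by fun_prop) fun z hz hz0 => ?_
    have := h1 hz
    simp only [mem_ofPred_eq, hz0, Complex.zero_re] at this
    linarith
  · intro z hz
    have hz0 : z ≠ 0 := by rintro rfl; simp at hz
    have hs : 1 < (1 + z).re := by simpa using hz
    have hs0 : 1 + z ≠ 0 := by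
      intro h0; rw [h0] at hs; simp at hs; linarith
    have h1 : ∫ u in Ioi (0 : ℝ), Complex.exp (-z * u) = 1 / z := by
      rw [integral_exp_mul_complex_Ioi (by simpa using hz)]
      simp
    have h2 := hval (1 + z) hs
    rw [add_sub_cancel_left] at h2
    have h3 : ∀ u : ℝ, ((summatory w ℓ u / c * Real.exp (-u) - 1 : ℝ) : ℂ) * Complex.exp (-z * u)
        = ((summatory w ℓ u : ℝ) : ℂ) * Complex.exp (-(1 + z) * u) / c - Complex.exp (-z * u) := by
      intro u
      have : Complex.exp (-(1 + z) * u) = Complex.exp (-u) * Complex.exp (-z * u) := by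
        rw [← Complex.exp_add]; ring_nf
      rw [this]
      push_cast
      ring
    simp_rw [h3]
    rw [integral_sub ((hint (1 + z) hs).div_const _) (integrableOn_cexp_neg_mul hz 0), h1,
      integral_div, h2]
    field_simp
    ring

open GaussianPNT

/-! ### Angular characters -/

/-- The angular character `z ↦ (z / |z|) ^ n`, extended by zero. -/
def angChar (n : ℤ) (z : ℂ) : ℂ := if z = 0 then 0 else (z / ‖z‖) ^ n

@[simp] lemma angChar_zero (n : ℤ) : angChar n 0 = 0 := if_pos rfl

lemma angChar_of_ne {z : ℂ} (hz : z ≠ 0) (n : ℤ) : angChar n z = (z / ‖z‖) ^ n := if_neg hz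

lemma norm_div_norm {z : ℂ} (hz : z ≠ 0) : ‖z / ‖z‖‖ = 1 := by
  rw [norm_div, Complex.norm_real, norm_norm, div_self (norm_ne_zero_iff.2 hz)]

lemma norm_angChar {z : ℂ} (hz : z ≠ 0) (n : ℤ) : ‖angChar n z‖ = 1 := by
  rw [angChar_of_ne hz, norm_zpow, norm_div_norm hz, one_zpow]

lemma norm_angChar_le (n : ℤ) (z : ℂ) : ‖angChar n z‖ ≤ 1 := by
  rcases eq_or_ne z 0 with rfl | hz
  · simp
  · exact (norm_angChar hz n).le

lemma angChar_mul (n : ℤ) (z w : ℂ) : angChar n (z * w) = angChar n z * angChar n w := by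
  rcases eq_or_ne z 0 with rfl | hz
  · simp
  rcases eq_or_ne w 0 with rfl | hw
  · simp
  rw [angChar_of_ne hz, angChar_of_ne hw, angChar_of_ne (mul_ne_zero hz hw), ← mul_zpow, norm_mul]
  push_cast
  rw [mul_div_mul_comm]

lemma angChar_zero_left {z : ℂ} (hz : z ≠ 0) : angChar 0 z = 1 := by
  rw [angChar_of_ne hz, zpow_zero]

lemma measurable_angChar (n : ℤ) : Measurable (angChar n) := by
  unfold angChar
  refine Measurable.ite (measurableSet_singleton 0) measurable_const ?_
  cases n with
  | ofNat m => simp only [Int.ofNat_eq_natCast, zpow_natCast]; fun_prop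
  | negSucc m => simp only [zpow_negSucc]; fun_prop

lemma norm_pow_sub_pow_le_of_norm_eq_one {a b : ℂ} (ha : ‖a‖ = 1) (hb : ‖b‖ = 1) (m : ℕ) :
    ‖a ^ m - b ^ m‖ ≤ m * ‖a - b‖ := by
  induction m with
  | zero => simp
  | succ m ih =>
    have : a ^ (m + 1) - b ^ (m + 1) = (a ^ m - b ^ m) * a + b ^ m * (a - b) := by ring
    rw [this]
    refine (norm_add_le _ _).trans ?_
    rw [norm_mul, norm_mul, ha, norm_pow, hb, one_pow]
    push_cast
    linarith

lemma norm_zpow_sub_zpow_le_of_norm_eq_one {a b : ℂ} (ha : ‖a‖ = 1) (hb : ‖b‖ = 1) (n : ℤ) :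
    ‖a ^ n - b ^ n‖ ≤ |(n : ℝ)| * ‖a - b‖ := by
  obtain ⟨m, rfl | rfl⟩ := n.eq_nat_or_neg
  · simpa using norm_pow_sub_pow_le_of_norm_eq_one ha hb m
  · have ha0 : a ≠ 0 := norm_ne_zero_iff.1 (by rw [ha]; exact one_ne_zero)
    have hb0 : b ≠ 0 := norm_ne_zero_iff.1 (by rw [hb]; exact one_ne_zero)
    have : a ^ (-(m : ℤ)) - b ^ (-(m : ℤ)) = -(a ^ m - b ^ m) * (a ^ m)⁻¹ * (b ^ m)⁻¹ := by
      rw [zpow_neg, zpow_neg, zpow_natCast, zpow_natCast]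
      field_simp
      ring
    rw [this]
    simpa [ha, hb, norm_sub_rev] using norm_pow_sub_pow_le_of_norm_eq_one ha hb m

/-- The `n`-th power is `|n|`-Lipschitz on the unit circle, and projecting radially to the circle
costs a factor `2 / ‖z‖`. The bound is useful only far from the origin. -/
lemma norm_angChar_sub_le {z w : ℂ} (hz : z ≠ 0) (hw : w ≠ 0) (n : ℤ) :
    ‖angChar n w - angChar n z‖ ≤ |(n : ℝ)| * (2 * ‖w - z‖ / ‖z‖) := by
  rw [angChar_of_ne hz, angChar_of_ne hw]
  refine (norm_zpow_sub_zpow_le_of_norm_eq_one (norm_div_norm hw) (norm_div_norm hz) n).trans ?_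
  refine mul_le_mul_of_nonneg_left ?_ (abs_nonneg _)
  have hz' : 0 < ‖z‖ := norm_pos_iff.2 hz
  have hzc : (‖z‖ : ℂ) ≠ 0 := by exact_mod_cast hz'.ne'
  have hwc : (‖w‖ : ℂ) ≠ 0 := by exact_mod_cast (norm_pos_iff.2 hw).ne'
  have h1 : w / ‖w‖ - z / ‖z‖ = ((w / ‖w‖) * ((‖z‖ - ‖w‖ : ℝ) : ℂ) + (w - z)) / ‖z‖ := by
    push_cast
    field_simp
    ring
  rw [h1, norm_div, Complex.norm_real, norm_norm]
  refine div_le_div_of_nonneg_right ?_ hz'.le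
  refine (norm_add_le _ _).trans ?_
  rw [norm_mul, norm_div_norm hw, one_mul, Complex.norm_real]
  have := abs_norm_sub_norm_le z w
  rw [norm_sub_rev] at this
  rw [Real.norm_eq_abs]
  linarith

/-! ### Lattice points in discs, weighted by an angular character -/

/-- The Gaussian integer at the lower left corner of the unit square containing `z`. -/
def floorGauss (z : ℂ) : GaussianInt := ⟨⌊z.re⌋, ⌊z.im⌋⟩

lemma norm_floorGauss_sub_le (z : ℂ) : ‖GaussianInt.toComplex (floorGauss z) - z‖ ≤ 2 := by
  refine (Complex.norm_le_abs_re_add_abs_im _).trans ?_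
  rw [GaussianInt.toComplex_def₂]
  simp only [floorGauss, Complex.sub_re, Complex.sub_im]
  have h1 : |(⌊z.re⌋ : ℝ) - z.re| ≤ 1 := by
    rw [abs_le]; constructor <;> linarith [Int.floor_le z.re, Int.lt_floor_add_one z.re]
  have h2 : |(⌊z.im⌋ : ℝ) - z.im| ≤ 1 := by
    rw [abs_le]; constructor <;> linarith [Int.floor_le z.im, Int.lt_floor_add_one z.im]
  linarith

lemma floorGauss_preimage (ω : GaussianInt) : floorGauss ⁻¹' {ω}
    = Complex.measurableEquivRealProd ⁻¹'
      (Ico (ω.re : ℝ) (ω.re + 1) ×ˢ Ico (ω.im : ℝ) (ω.im + 1)) := by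
  ext z
  simp [floorGauss, Zsqrtd.ext_iff, Complex.measurableEquivRealProd_apply, Int.floor_eq_iff]

lemma measurableSet_floorGauss_preimage (ω : GaussianInt) :
    MeasurableSet (floorGauss ⁻¹' {ω}) := by
  rw [floorGauss_preimage]
  exact Complex.measurableEquivRealProd.measurable (measurableSet_Ico.prod measurableSet_Ico)

lemma volume_floorGauss_preimage (ω : GaussianInt) : volume (floorGauss ⁻¹' {ω}) = 1 := by
  rw [floorGauss_preimage, Complex.volume_preserving_equiv_real_prod.measure_preimage
    (measurableSet_Ico.prod measurableSet_Ico).nullMeasurableSet, Measure.volume_eq_prod,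
    Measure.prod_prod]
  simp

lemma norm_toComplex_sq (ω : GaussianInt) :
    ‖GaussianInt.toComplex ω‖ ^ 2 = ((Zsqrtd.norm ω : ℤ) : ℝ) := by
  rw [GaussianInt.intCast_real_norm, Complex.normSq_eq_norm_sq]

lemma mem_ball_sq_iff {ω : GaussianInt} {R : ℝ} (hR : 0 ≤ R) :
    ω ∈ ball (R ^ 2) ↔ ‖GaussianInt.toComplex ω‖ ≤ R := by
  rw [← pow_le_pow_iff_left₀ (norm_nonneg _) hR two_ne_zero, norm_toComplex_sq]
  rfl

/-- The unit squares have area 1, so a lattice sum is the integral of a step function. -/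
lemma hasIntegral_step (c : GaussianInt → ℂ) (s : Finset GaussianInt) :
    Integrable (fun z => if floorGauss z ∈ s then c (floorGauss z) else 0) ∧
    ∫ z, (if floorGauss z ∈ s then c (floorGauss z) else 0) = ∑ ω ∈ s, c ω := by
  have h1 : (fun z => if floorGauss z ∈ s then c (floorGauss z) else 0)
      = fun z => ∑ ω ∈ s, (floorGauss ⁻¹' {ω}).indicator (fun _ => c ω) z := by
    ext z
    have : ∀ ω, (floorGauss ⁻¹' {ω}).indicator (fun _ => c ω) z
        = if floorGauss z = ω then c ω else 0 := fun ω => by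
      by_cases h : floorGauss z = ω <;> simp [indicator, h]
    simp_rw [this]
    rw [Finset.sum_ite_eq]
  have h2 : ∀ ω ∈ s, Integrable ((floorGauss ⁻¹' {ω}).indicator (fun _ => c ω)) := fun ω _ =>
    (integrable_indicator_iff (measurableSet_floorGauss_preimage ω)).2
      (integrableOn_const (by rw [volume_floorGauss_preimage]; exact ENNReal.one_ne_top))
  rw [h1]
  refine ⟨integrable_finsetSum _ h2, ?_⟩
  rw [integral_finsetSum _ h2]
  refine Finset.sum_congr rfl fun ω _ => ?_
  rw [integral_indicator_const _ (measurableSet_floorGauss_preimage ω), Measure.real,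
    volume_floorGauss_preimage]
  simp

lemma volumeReal_closedBall {R : ℝ} (hR : 0 ≤ R) :
    volume.real (Metric.closedBall (0 : ℂ) R) = Real.pi * R ^ 2 := by
  rw [Measure.real, Complex.volume_closedBall, ENNReal.toReal_mul, ENNReal.toReal_pow,
    ENNReal.toReal_ofReal hR]
  simp [mul_comm]

lemma integrable_disc_angChar (n : ℤ) (R : ℝ) :
    Integrable ((Metric.closedBall (0 : ℂ) R).indicator (angChar n)) := by
  refine (integrable_indicator_iff measurableSet_closedBall).2 ?_
  refine Integrable.mono' (g := fun _ => (1 : ℝ)) (integrableOn_const ?_)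
    (measurable_angChar n).aestronglyMeasurable (Eventually.of_forall fun z => norm_angChar_le n z)
  exact (isCompact_closedBall _ _).measure_lt_top.ne

/-- For `n ≠ 0`, rotation by `π / n` preserves the disc and its area but negates the character, so
the integral equals its own negative. -/
lemma integral_disc_angChar (n : ℤ) {R : ℝ} (hR : 0 ≤ R) :
    ∫ z, (Metric.closedBall (0 : ℂ) R).indicator (angChar n) z
      = if n = 0 then ((Real.pi * R ^ 2 : ℝ) : ℂ) else 0 := by
  split_ifs with hn
  · subst hn
    have : (Metric.closedBall (0 : ℂ) R).indicator (angChar 0)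
        =ᵐ[volume] (Metric.closedBall (0 : ℂ) R).indicator (fun _ => (1 : ℂ)) := by
      filter_upwards [Measure.ae_ne volume (0 : ℂ)] with z hz
      simp [indicator, angChar_zero_left hz]
    rw [integral_congr_ae this, integral_indicator_const _ measurableSet_closedBall,
      volumeReal_closedBall hR]
    simp
  · set D := (Metric.closedBall (0 : ℂ) R).indicator (angChar n) with hD
    set a : Circle := Circle.exp (Real.pi / n) with ha
    have han : angChar n (a : ℂ) = -1 := by
      rw [angChar_of_ne (Circle.coe_ne_zero a), Circle.norm_coe, Complex.ofReal_one, div_one, ha,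
        Circle.coe_exp, ← Complex.exp_int_mul]
      have hnc : (n : ℂ) ≠ 0 := by exact_mod_cast hn
      rw [← Complex.exp_pi_mul_I]
      congr 1
      push_cast
      field_simp
    have h1 := ((rotation a).measurePreserving).integral_comp
      (rotation a).toHomeomorph.measurableEmbedding D
    have h2 : ∀ z, D (rotation a z) = -D z := by
      intro z
      simp only [hD, rotation_apply, indicator, Metric.mem_closedBall, dist_zero_right, norm_mul,
        Circle.norm_coe, one_mul, angChar_mul, han]
      split_ifs <;> simp
    simp_rw [h2, integral_neg] at h1
    exact self_eq_neg.1 h1.symm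

/-- Near the origin the character oscillates too fast, and near the circle `z` and its lattice point
may lie on different sides; both regions get the trivial bound 2. Elsewhere in the disc `‖z‖ > 2
√R`, so the Lipschitz bound with displacement at most 2 gives `2 |n| / √R`. Beyond `R + 2` both
terms vanish. -/
lemma norm_step_sub_disc_le (n : ℤ) {R : ℝ} (hR : 1 ≤ R) (z : ℂ) :
    ‖(if floorGauss z ∈ (ball_finite (R ^ 2)).toFinset
        then angChar n (GaussianInt.toComplex (floorGauss z)) else 0)
      - (Metric.closedBall (0 : ℂ) R).indicator (angChar n) z‖
    ≤ (Metric.closedBall (0 : ℂ) (2 * √R)).indicator (fun _ => (2 : ℝ)) z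
      + (Metric.closedBall (0 : ℂ) (R + 2) \ Metric.ball (0 : ℂ) (R - 2)).indicator
        (fun _ => (2 : ℝ)) z
      + (Metric.closedBall (0 : ℂ) R).indicator (fun _ => 2 * |(n : ℝ)| / √R) z := by
  have hR0 : 0 ≤ R := by linarith
  set w := GaussianInt.toComplex (floorGauss z) with hw
  have hwz : ‖w - z‖ ≤ 2 := norm_floorGauss_sub_le z
  have hsq : 1 ≤ √R := Real.one_le_sqrt.2 hR
  have hin : floorGauss z ∈ (ball_finite (R ^ 2)).toFinset ↔ ‖w‖ ≤ R := by
    rw [Set.Finite.mem_toFinset, mem_ball_sq_iff hR0]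
  have hdist := abs_norm_sub_norm_le w z
  rw [abs_le] at hdist
  simp only [hin, indicator, Metric.mem_closedBall, dist_zero_right, Set.mem_sdiff, Metric.mem_ball,
    not_lt]
  have htriv : ‖(if ‖w‖ ≤ R then angChar n w else 0) - (if ‖z‖ ≤ R then angChar n z else 0)‖ ≤ 2 := by
    refine (norm_sub_le _ _).trans ?_
    have h1 : ‖(if ‖w‖ ≤ R then angChar n w else 0)‖ ≤ 1 := by
      split_ifs <;> simp [norm_angChar_le]
    have h2 : ‖(if ‖z‖ ≤ R then angChar n z else 0)‖ ≤ 1 := by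
      split_ifs <;> simp [norm_angChar_le]
    linarith
  have p1 : 0 ≤ (if ‖z‖ ≤ 2 * √R then (2 : ℝ) else 0) := by split_ifs <;> norm_num
  have p2 : 0 ≤ (if ‖z‖ ≤ R + 2 ∧ R - 2 ≤ ‖z‖ then (2 : ℝ) else 0) := by split_ifs <;> norm_num
  have p3 : 0 ≤ (if ‖z‖ ≤ R then 2 * |(n : ℝ)| / √R else 0) := by split_ifs <;> positivity
  by_cases c1 : ‖z‖ ≤ 2 * √R
  · rw [if_pos c1]; linarith
  by_cases c2 : ‖z‖ ≤ R + 2 ∧ R - 2 ≤ ‖z‖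
  · rw [if_pos c2]; linarith
  by_cases c3 : ‖z‖ ≤ R + 2
  · have hz : ‖z‖ < R - 2 := by
      by_contra! h; exact c2 ⟨c3, h⟩
    have hzR : ‖z‖ ≤ R := by linarith
    have hwR : ‖w‖ ≤ R := by linarith [hdist.2]
    push Not at c1
    have hzpos : 0 < ‖z‖ := by linarith
    have hwpos : 0 < ‖w‖ := by linarith [hdist.1]
    rw [if_pos hzR] at p3 ⊢
    rw [if_pos hwR, if_pos hzR]
    refine le_trans (norm_angChar_sub_le (norm_pos_iff.1 hzpos) (norm_pos_iff.1 hwpos) n) ?_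
    have : |(n : ℝ)| * (2 * ‖w - z‖ / ‖z‖) ≤ 2 * |(n : ℝ)| / √R := by
      rw [mul_comm 2 |(n : ℝ)|, mul_div_assoc |(n : ℝ)|]
      refine mul_le_mul_of_nonneg_left ?_ (abs_nonneg _)
      rw [div_le_div_iff₀ hzpos (by linarith)]
      nlinarith
    linarith
  · push Not at c3
    have hzR : ¬ ‖z‖ ≤ R := by linarith
    have hwR : ¬ ‖w‖ ≤ R := by linarith [hdist.1]
    rw [if_neg hzR] at p3 ⊢
    rw [if_neg hzR, if_neg hwR]
    simp only [sub_zero, norm_zero]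
    linarith

/-- The sum of an angular character over the lattice points in a disc of radius `R` agrees with
the integral over the disc up to `O(R ^ (3/2))`. -/
theorem norm_sum_angChar_sub_le (n : ℤ) : ∃ C : ℝ, ∀ R : ℝ, 1 ≤ R →
    ‖∑ ω ∈ (ball_finite (R ^ 2)).toFinset, angChar n (GaussianInt.toComplex ω)
      - (if n = 0 then ((Real.pi * R ^ 2 : ℝ) : ℂ) else 0)‖ ≤ C * (R * √R) := by
  -- The inner disc contributes `8 π R`, the annulus at most `32 π R`, and the rest `2 |n| π R √R`.
  refine ⟨Real.pi * (8 + 32 + 2 * |(n : ℝ)|), fun R hR => ?_⟩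
  have hR0 : 0 ≤ R := by linarith
  have hsq : 1 ≤ √R := Real.one_le_sqrt.2 hR
  have hsq2 : √R ^ 2 = R := Real.sq_sqrt hR0
  obtain ⟨i1, e1⟩ := hasIntegral_step (fun ω => angChar n (GaussianInt.toComplex ω))
    (ball_finite (R ^ 2)).toFinset
  have i2 := integrable_disc_angChar n R
  rw [← e1, ← integral_disc_angChar n hR0, ← integral_sub i1 i2]
  have hfin : ∀ r : ℝ, volume (Metric.closedBall (0 : ℂ) r) ≠ ⊤ := fun r =>
    (isCompact_closedBall _ _).measure_lt_top.ne
  have hind : ∀ (s : Set ℂ) (c : ℝ), MeasurableSet s → volume s ≠ ⊤ →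
      Integrable (s.indicator fun _ => c) := fun s c hs hf =>
    (integrable_indicator_iff hs).2 (integrableOn_const hf)
  have j1 := hind (Metric.closedBall 0 (2 * √R)) 2 measurableSet_closedBall (hfin _)
  have j2 := hind (Metric.closedBall 0 (R + 2) \ Metric.ball 0 (R - 2)) 2
    (measurableSet_closedBall.diff measurableSet_ball)
    (ne_top_of_le_ne_top (hfin (R + 2)) (measure_mono sdiff_subset))
  have j3 := hind (Metric.closedBall 0 R) (2 * |(n : ℝ)| / √R) measurableSet_closedBall (hfin _)
  refine (norm_integral_le_of_norm_le ((j1.add j2).add j3)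
    (Eventually.of_forall fun z => norm_step_sub_disc_le n hR z)).trans ?_
  have hann : volume.real (Metric.closedBall (0 : ℂ) (R + 2) \ Metric.ball 0 (R - 2))
      ≤ Real.pi * (16 * R) := by
    have hpi := Real.pi_pos
    rcases le_total R 2 with h2 | h2
    · refine (measureReal_mono sdiff_subset (hfin _)).trans ?_
      rw [volumeReal_closedBall (by linarith)]
      refine mul_le_mul_of_nonneg_left ?_ hpi.le
      nlinarith
    · rw [measureReal_sdiff (Metric.ball_subset_closedBall.trans
          (Metric.closedBall_subset_closedBall (by linarith))) measurableSet_ball (hfin _),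
        volumeReal_closedBall (by linarith)]
      have : volume.real (Metric.ball (0 : ℂ) (R - 2)) = Real.pi * (R - 2) ^ 2 := by
        rw [← volumeReal_closedBall (by linarith), Measure.real, Measure.real,
          Complex.volume_closedBall, Complex.volume_ball]
      rw [this]
      nlinarith
  have hsum : ∫ z, (((Metric.closedBall (0 : ℂ) (2 * √R)).indicator (fun _ => (2 : ℝ))
      + (Metric.closedBall (0 : ℂ) (R + 2) \ Metric.ball (0 : ℂ) (R - 2)).indicator
        (fun _ => (2 : ℝ)))
      + (Metric.closedBall (0 : ℂ) R).indicator (fun _ => 2 * |(n : ℝ)| / √R)) z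
      = Real.pi * (2 * √R) ^ 2 * 2
        + volume.real (Metric.closedBall (0 : ℂ) (R + 2) \ Metric.ball 0 (R - 2)) * 2
        + Real.pi * R ^ 2 * (2 * |(n : ℝ)| / √R) := by
    rw [integral_add' (j1.add j2) j3, integral_add' j1 j2,
      integral_indicator_const _ measurableSet_closedBall,
      integral_indicator_const _ measurableSet_closedBall,
      integral_indicator_const _ (measurableSet_closedBall.diff measurableSet_ball),
      volumeReal_closedBall (by positivity), volumeReal_closedBall hR0]
    simp only [smul_eq_mul]
  refine (le_of_eq hsum).trans ?_
  have h3 : Real.pi * R ^ 2 * (2 * |(n : ℝ)| / √R) = Real.pi * (2 * |(n : ℝ)|) * (R * √R) := by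
    nth_rewrite 1 [← hsq2]
    field_simp
    rw [hsq2, mul_comm]
  rw [h3, mul_pow, hsq2]
  have h4 : R ≤ R * √R := le_mul_of_one_le_right hR0 hsq
  have h5 := mul_le_mul_of_nonneg_left h4 Real.pi_pos.le
  nlinarith

/-! ### Arithmetic of the Gaussian integers -/

instance : Countable GaussianInt :=
  Function.Injective.countable (f := fun ω : GaussianInt => (ω.re, ω.im)) fun a b h => by
    simp only [Prod.mk.injEq] at h
    exact Zsqrtd.ext h.1 h.2

/-- The logarithm of the norm of a Gaussian integer. -/
def logNorm (ω : GaussianInt) : ℝ := Real.log ((Zsqrtd.norm ω : ℤ) : ℝ)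

lemma one_le_norm {ω : GaussianInt} (hω : ω ≠ 0) : (1 : ℝ) ≤ ((Zsqrtd.norm ω : ℤ) : ℝ) := by
  exact_mod_cast (GaussianInt.norm_pos.2 hω : 0 < Zsqrtd.norm ω)

lemma logNorm_nonneg (ω : GaussianInt) : 0 ≤ logNorm ω := by
  rcases eq_or_ne ω 0 with rfl | h
  · simp [logNorm]
  · exact Real.log_nonneg (one_le_norm h)

lemma logNorm_mul {a b : GaussianInt} (ha : a ≠ 0) (hb : b ≠ 0) :
    logNorm (a * b) = logNorm a + logNorm b := by
  have h1 := one_le_norm ha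
  have h2 := one_le_norm hb
  rw [logNorm, Zsqrtd.norm_mul, Int.cast_mul, Real.log_mul (by linarith) (by linarith)]
  rfl

lemma norm_eq_one_iff_isUnit (ω : GaussianInt) : Zsqrtd.norm ω = 1 ↔ IsUnit ω :=
  Zsqrtd.norm_eq_one_iff' (by norm_num) ω

lemma logNorm_of_isUnit {ω : GaussianInt} (hω : IsUnit ω) : logNorm ω = 0 := by
  rw [logNorm, (norm_eq_one_iff_isUnit ω).2 hω]; simp

lemma two_le_norm_of_prime {p : GaussianInt} (hp : Prime p) : (2 : ℝ) ≤ ((Zsqrtd.norm p : ℤ) : ℝ) := by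
  have h1 : 0 < Zsqrtd.norm p := GaussianInt.norm_pos.2 hp.ne_zero
  have h2 : Zsqrtd.norm p ≠ 1 := fun h => hp.not_isUnit ((norm_eq_one_iff_isUnit p).1 h)
  have : 2 ≤ Zsqrtd.norm p := by omega
  exact_mod_cast this

lemma log_two_le_logNorm {p : GaussianInt} (hp : Prime p) : Real.log 2 ≤ logNorm p :=
  Real.log_le_log two_pos (two_le_norm_of_prime hp)

lemma logNorm_pos_of_prime {p : GaussianInt} (hp : Prime p) : 0 < logNorm p :=
  (Real.log_pos one_lt_two).trans_le (log_two_le_logNorm hp)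

/-- The four units of `ℤ[i]`. -/
def gaussUnits : Finset GaussianInt := {1, -1, ⟨0, 1⟩, ⟨0, -1⟩}

lemma card_gaussUnits : gaussUnits.card = 4 := by decide

lemma mem_gaussUnits_iff {u : GaussianInt} : u ∈ gaussUnits ↔ IsUnit u := by
  rw [← norm_eq_one_iff_isUnit]
  constructor
  · intro h
    simp only [gaussUnits, Finset.mem_insert, Finset.mem_singleton] at h
    rcases h with rfl | rfl | rfl | rfl <;> decide
  · intro h
    obtain ⟨a, b⟩ := u
    rw [Zsqrtd.norm_def] at h
    simp only at h
    have ha : -1 ≤ a ∧ a ≤ 1 := ⟨by nlinarith [mul_self_nonneg b], by nlinarith [mul_self_nonneg b]⟩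
    have hb : -1 ≤ b ∧ b ≤ 1 := ⟨by nlinarith [mul_self_nonneg a], by nlinarith [mul_self_nonneg a]⟩
    obtain ⟨ha1, ha2⟩ := ha
    obtain ⟨hb1, hb2⟩ := hb
    interval_cases a <;> interval_cases b <;> simp_all [gaussUnits, Zsqrtd.ext_iff]

/-- The weight `log N(q)` on the primes `q` of `ℤ[i]`. -/
def primeLog (q : GaussianInt) : ℝ :=
  open Classical in if Prime q then logNorm q else 0

lemma primeLog_of_prime {q : GaussianInt} (hq : Prime q) : primeLog q = logNorm q := if_pos hq

lemma primeLog_of_not_prime {q : GaussianInt} (hq : ¬ Prime q) : primeLog q = 0 := if_neg hq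

lemma primeLog_nonneg (q : GaussianInt) : 0 ≤ primeLog q := by
  unfold primeLog; split_ifs <;> simp [logNorm_nonneg]

lemma primeLog_le (q : GaussianInt) : primeLog q ≤ logNorm q := by
  unfold primeLog; split_ifs <;> simp [logNorm_nonneg]

-- A prime has exactly four associates, all of the same norm; this is the source of the factor 4
-- throughout.
open Classical in
lemma hasSum_primeLog_associated {p : GaussianInt} (hp : Prime p) :
    HasSum (fun q => primeLog q * (if Associated q p then 1 else 0)) (4 * logNorm p) := by
  set T : Finset GaussianInt := gaussUnits.image fun u => u * p with hT
  have hcard : T.card = 4 := by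
    rw [hT, Finset.card_image_of_injective _ (mul_left_injective₀ hp.ne_zero), card_gaussUnits]
  have hmem : ∀ q, q ∈ T ↔ Associated q p := by
    intro q
    rw [hT, Finset.mem_image]
    constructor
    · rintro ⟨u, hu, rfl⟩
      exact associated_unit_mul_left _ _ (mem_gaussUnits_iff.1 hu)
    · intro h
      obtain ⟨u, hu⟩ := h.symm
      exact ⟨u, mem_gaussUnits_iff.2 u.isUnit, by rw [mul_comm]; exact hu⟩
  have h1 : ∑ q ∈ T, primeLog q * (if Associated q p then 1 else 0) = 4 * logNorm p := by
    have h4 : (4 : ℝ) = (T.card : ℝ) := by rw [hcard]; norm_num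
    rw [h4, ← nsmul_eq_mul, ← Finset.sum_const]
    refine Finset.sum_congr rfl fun q hq => ?_
    have hqp := (hmem q).1 hq
    rw [if_pos hqp, mul_one, primeLog_of_prime (hqp.prime_iff.2 hp)]
    obtain ⟨u, rfl⟩ := hqp.symm
    rw [logNorm_mul hp.ne_zero u.ne_zero, logNorm_of_isUnit u.isUnit, add_zero]
  rw [← h1]
  refine hasSum_sum_of_ne_finset_zero fun q hq => ?_
  rw [if_neg fun h => hq ((hmem q).2 h), mul_zero]

/-- The identity `∑_q v_q(ω) log N(q) = 4 log N(ω)`, the sum being over all primes of `ℤ[i]`. -/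
lemma hasSum_primeLog_mul_multiplicity {ω : GaussianInt} (hω : ω ≠ 0) :
    HasSum (fun q => primeLog q * (multiplicity q ω : ℝ)) (4 * logNorm ω) := by
  classical
  induction ω using UniqueFactorizationMonoid.induction_on_prime with
  | h₁ => exact absurd rfl hω
  | h₂ x hx =>
    rw [logNorm_of_isUnit hx, mul_zero]
    have : (fun q => primeLog q * (multiplicity q x : ℝ)) = fun _ => 0 := by
      ext q
      by_cases hq : Prime q
      · rw [multiplicity_eq_zero.2 fun h => hq.not_isUnit (isUnit_of_dvd_unit h hx)]
        simp
      · simp [primeLog_of_not_prime hq]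
    rw [this]
    exact hasSum_zero
  | h₃ a p ha hp ih =>
    rw [logNorm_mul hp.ne_zero ha, mul_add]
    have : (fun q => primeLog q * (multiplicity q (p * a) : ℝ))
        = fun q => primeLog q * (if Associated q p then 1 else 0)
          + primeLog q * (multiplicity q a : ℝ) := by
      ext q
      by_cases hq : Prime q
      · rw [multiplicity_mul hq (FiniteMultiplicity.of_prime_left hq hω)]
        have h1 : multiplicity q p = if Associated q p then 1 else 0 := by
          split_ifs with h
          · rw [multiplicity_eq_of_associated_left h.symm, multiplicity_self]
          · exact multiplicity_eq_zero.2 fun hd => h ((hq.dvd_prime_iff_associated hp).1 hd)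
        rw [h1]
        push_cast
        ring
      · simp [primeLog_of_not_prime hq]
    rw [this]
    exact (hasSum_primeLog_associated hp).add (ih ha)

/-! ### The Hecke L-series -/

/-- The general term `χ_n(ω) N(ω)^{-s}` of the Hecke L-series. -/
def heckeTerm (n : ℤ) (s : ℂ) (ω : GaussianInt) : ℂ :=
  angChar n (GaussianInt.toComplex ω) * Complex.exp (-s * logNorm ω)

@[simp] lemma heckeTerm_zero (n : ℤ) (s : ℂ) : heckeTerm n s 0 = 0 := by simp [heckeTerm]

/-- The Hecke L-series `∑ χ_n(ω) N(ω)^{-s}` over all nonzero Gaussian integers. -/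
def heckeL (n : ℤ) (s : ℂ) : ℂ := ∑' ω, heckeTerm n s ω

lemma heckeTerm_mul (n : ℤ) (s : ℂ) (a b : GaussianInt) :
    heckeTerm n s (a * b) = heckeTerm n s a * heckeTerm n s b := by
  rcases eq_or_ne a 0 with rfl | ha
  · simp
  rcases eq_or_ne b 0 with rfl | hb
  · simp
  rw [heckeTerm, heckeTerm, heckeTerm, logNorm_mul ha hb, map_mul, angChar_mul]
  push_cast
  rw [mul_add, Complex.exp_add]
  ring

lemma norm_heckeTerm (n : ℤ) (s : ℂ) {ω : GaussianInt} (hω : ω ≠ 0) :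
    ‖heckeTerm n s ω‖ = Real.exp (-s.re * logNorm ω) := by
  rw [heckeTerm, norm_mul, norm_angChar (by simpa using hω), one_mul, Complex.norm_exp]
  simp

lemma norm_heckeTerm_le (n : ℤ) (s : ℂ) (ω : GaussianInt) :
    ‖heckeTerm n s ω‖ ≤ Real.exp (-s.re * logNorm ω) := by
  rcases eq_or_ne ω 0 with rfl | hω
  · simp [Real.exp_nonneg]
  · exact (norm_heckeTerm n s hω).le

/-- Comparison with the Eisenstein lattice sum of exponent `2 σ > 2`, as the squared sup norm is at
most `N(ω)`. The comparison is made only off `ω = 0`, where `logNorm` takes the default value 0. -/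
lemma summable_exp_neg_mul_logNorm {σ : ℝ} (hσ : 1 < σ) :
    Summable fun ω => Real.exp (-σ * logNorm ω) := by
  have h1 := EisensteinSeries.summable_one_div_norm_rpow (k := 2 * σ) (by linarith)
  have hinj : Function.Injective fun ω : GaussianInt => (![ω.re, ω.im] : Fin 2 → ℤ) := by
    intro a b h
    exact Zsqrtd.ext (by simpa using congrFun h 0) (by simpa using congrFun h 1)
  have h2 := h1.comp_injective hinj
  refine Summable.of_norm_bounded_eventually h2 ?_
  refine (Set.finite_singleton (0 : GaussianInt)).subset fun ω hω => ?_
  by_contra hω0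
  refine hω ?_
  have hω0 : ω ≠ 0 := hω0
  have hN := one_le_norm hω0
  have hsup : ‖(![ω.re, ω.im] : Fin 2 → ℤ)‖ ^ 2 ≤ ((Zsqrtd.norm ω : ℤ) : ℝ) := by
    rw [← norm_toComplex_sq]
    refine pow_le_pow_left₀ (norm_nonneg _) ?_ 2
    refine (pi_norm_le_iff_of_nonneg (norm_nonneg _)).2 fun i => ?_
    have hre := Complex.abs_re_le_norm (GaussianInt.toComplex ω)
    have him := Complex.abs_im_le_norm (GaussianInt.toComplex ω)
    rw [← GaussianInt.intCast_re] at hre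
    rw [← GaussianInt.intCast_im] at him
    fin_cases i
    · simpa [Int.norm_eq_abs] using hre
    · simpa [Int.norm_eq_abs] using him
  have hpos : 0 < ‖(![ω.re, ω.im] : Fin 2 → ℤ)‖ := by
    rw [norm_pos_iff]
    intro h
    exact hω0 (hinj (by simpa using h))
  change ‖Real.exp (-σ * logNorm ω)‖ ≤ ‖(![ω.re, ω.im] : Fin 2 → ℤ)‖ ^ (-(2 * σ))
  rw [Real.norm_of_nonneg (Real.exp_pos _).le, logNorm, mul_comm, ← Real.rpow_def_of_pos (by linarith)]
  calc ((Zsqrtd.norm ω : ℤ) : ℝ) ^ (-σ) ≤ (‖(![ω.re, ω.im] : Fin 2 → ℤ)‖ ^ 2) ^ (-σ) :=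
        Real.rpow_le_rpow_of_nonpos (by positivity) hsup (by linarith)
    _ = ‖(![ω.re, ω.im] : Fin 2 → ℤ)‖ ^ (-(2 * σ)) := by
        rw [← Real.rpow_natCast, ← Real.rpow_mul hpos.le]; push_cast; ring_nf

/-- Half of the margin `σ - 1` absorbs the logarithm. -/
lemma summable_logNorm_mul_exp {σ : ℝ} (hσ : 1 < σ) :
    Summable fun ω => logNorm ω * Real.exp (-σ * logNorm ω) := by
  set δ := (σ - 1) / 2 with hδ
  have hδ0 : 0 < δ := by rw [hδ]; linarith
  refine Summable.of_nonneg_of_le (fun ω => mul_nonneg (logNorm_nonneg ω) (Real.exp_pos _).le)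
    (fun ω => ?_) ((summable_exp_neg_mul_logNorm (σ := 1 + δ) (by linarith)).mul_left (1 / δ))
  have h1 : logNorm ω ≤ 1 / δ * Real.exp (δ * logNorm ω) := by
    have := Real.add_one_le_exp (δ * logNorm ω)
    rw [div_mul_eq_mul_div, le_div_iff₀ hδ0]
    linarith
  refine (mul_le_mul_of_nonneg_right h1 (Real.exp_pos _).le).trans (le_of_eq ?_)
  rw [mul_assoc, ← Real.exp_add]
  congr 2
  rw [hδ]; ring

lemma summable_heckeTerm (n : ℤ) {s : ℂ} (hs : 1 < s.re) : Summable fun ω => heckeTerm n s ω :=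
  Summable.of_norm_bounded (summable_exp_neg_mul_logNorm hs) (norm_heckeTerm_le n s)

lemma isOpen_re_gt (a : ℝ) : IsOpen {s : ℂ | a < s.re} :=
  isOpen_lt continuous_const Complex.continuous_re

lemma hasSum_deriv_heckeL (n : ℤ) {s : ℂ} (hs : 1 < s.re) :
    DifferentiableAt ℂ (heckeL n) s ∧
      HasSum (fun ω => -(logNorm ω : ℂ) * heckeTerm n s ω) (deriv (heckeL n) s) := by
  obtain ⟨a, ha, has⟩ := exists_between hs
  have hd : ∀ ω (z : ℂ), HasDerivAt (fun z => heckeTerm n z ω)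
      (-(logNorm ω : ℂ) * heckeTerm n z ω) z := by
    intro ω z
    have h1 : HasDerivAt (fun z : ℂ => Complex.exp (-z * logNorm ω))
        (Complex.exp (-z * logNorm ω) * (-1 * logNorm ω)) z :=
      ((hasDerivAt_id z).neg.mul_const _).cexp
    refine (h1.const_mul (angChar n (GaussianInt.toComplex ω))).congr_deriv ?_
    rw [heckeTerm]; ring
  have hb : ∀ ω (z : ℂ), z ∈ {z : ℂ | a < z.re} →
      ‖heckeTerm n z ω‖ ≤ Real.exp (-a * logNorm ω) := by
    intro ω z hz
    refine (norm_heckeTerm_le n z ω).trans (Real.exp_le_exp.2 ?_)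
    have := logNorm_nonneg ω
    have hz : a < z.re := hz
    nlinarith
  have hdiff : ∀ ω, DifferentiableOn ℂ (fun z => heckeTerm n z ω) {z : ℂ | a < z.re} :=
    fun ω z _ => (hd ω z).differentiableAt.differentiableWithinAt
  refine ⟨(Complex.differentiableOn_tsum_of_summable_norm (summable_exp_neg_mul_logNorm ha) hdiff
    (isOpen_re_gt a) hb).differentiableAt ((isOpen_re_gt a).mem_nhds has), ?_⟩
  have := Complex.hasSum_deriv_of_summable_norm (summable_exp_neg_mul_logNorm ha) hdiff
    (isOpen_re_gt a) hb has
  simp only [(hd _ s).deriv] at this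
  exact this

/-! ### The logarithmic derivative -/

/-- Since `N(q) ≥ 2`, the denominators `1 - heckeTerm n s q` stay away from 0, even on the line `Re
s = 1`. -/
lemma norm_heckeTerm_prime_le (n : ℤ) {s : ℂ} (hs : 1 ≤ s.re) {q : GaussianInt} (hq : Prime q) :
    ‖heckeTerm n s q‖ ≤ 1 / 2 := by
  have h1 := logNorm_nonneg q
  calc ‖heckeTerm n s q‖ ≤ Real.exp (-s.re * logNorm q) := norm_heckeTerm_le n s q
    _ ≤ Real.exp (-Real.log 2) := Real.exp_le_exp.2 (by nlinarith [log_two_le_logNorm hq])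
    _ = 1 / 2 := by rw [Real.exp_neg, Real.exp_log two_pos]; norm_num

lemma summable_heckeTerm_mul_multiplicity (n : ℤ) {s : ℂ} (hs : 1 < s.re) {q : GaussianInt}
    (hq : Prime q) : Summable fun ω => heckeTerm n s ω * (multiplicity q ω : ℂ) := by
  refine Summable.of_norm_bounded ((summable_logNorm_mul_exp hs).mul_left (4 / logNorm q))
    fun ω => ?_
  have hq0 := logNorm_pos_of_prime hq
  rcases eq_or_ne ω 0 with rfl | hω
  · simp [logNorm]
  have h1 : logNorm q * (multiplicity q ω : ℝ) ≤ 4 * logNorm ω := by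
    rw [← primeLog_of_prime hq]
    exact le_hasSum (hasSum_primeLog_mul_multiplicity hω) q
      fun p _ => mul_nonneg (primeLog_nonneg p) (Nat.cast_nonneg _)
  rw [norm_mul, norm_heckeTerm n s hω, Complex.norm_natCast, mul_comm, ← mul_assoc]
  refine mul_le_mul_of_nonneg_right ?_ (Real.exp_pos _).le
  rw [div_mul_eq_mul_div, le_div_iff₀ hq0]
  linarith

/-- Only multiples of `q` contribute. Substituting `q ω` for `ω` and using `v_q(q ω) = 1 + v_q(ω)`,
the sum `X` satisfies `X = t (heckeL n s + X)`. -/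
lemma tsum_heckeTerm_mul_multiplicity (n : ℤ) {s : ℂ} (hs : 1 < s.re) {q : GaussianInt}
    (hq : Prime q) : ∑' ω, heckeTerm n s ω * (multiplicity q ω : ℂ)
      = heckeL n s * (heckeTerm n s q / (1 - heckeTerm n s q)) := by
  set t := heckeTerm n s q with ht
  have ht1 : 1 - t ≠ 0 := by
    intro h
    have := norm_heckeTerm_prime_le n hs.le hq
    rw [← ht, ← sub_eq_zero.1 h, norm_one] at this
    norm_num at this
  have hS := summable_heckeTerm_mul_multiplicity n hs hq
  have hinj : Function.Injective fun ω : GaussianInt => q * ω := mul_right_injective₀ hq.ne_zero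
  have hsupp : Function.support (fun ω => heckeTerm n s ω * (multiplicity q ω : ℂ))
      ⊆ range fun ω : GaussianInt => q * ω := by
    intro ω hω
    by_contra h
    refine hω ?_
    have : ¬ q ∣ ω := fun ⟨c, hc⟩ => h ⟨c, hc.symm⟩
    simp [multiplicity_eq_zero.2 this]
  have h1 : ∀ ω, heckeTerm n s (q * ω) * (multiplicity q (q * ω) : ℂ)
      = t * heckeTerm n s ω + t * (heckeTerm n s ω * (multiplicity q ω : ℂ)) := by
    intro ω
    rcases eq_or_ne ω 0 with rfl | hω
    · simp
    rw [heckeTerm_mul, multiplicity_mul hq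
      (FiniteMultiplicity.of_prime_left hq (mul_ne_zero hq.ne_zero hω)), multiplicity_self]
    push_cast
    ring
  have h2 := hinj.tsum_eq hsupp
  simp_rw [h1] at h2
  rw [Summable.tsum_add ((summable_heckeTerm n hs).mul_left t) (hS.mul_left t), tsum_mul_left,
    tsum_mul_left] at h2
  rw [← mul_div_assoc, eq_div_iff ht1, heckeL]
  linear_combination -h2

/-- The Dirichlet series of `χ_n` over the primes of `ℤ[i]` with weights `log N(q)`. -/
def primeSeries (n : ℤ) (s : ℂ) : ℂ := ∑' q, (primeLog q : ℂ) * heckeTerm n s q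

/-- The contribution of the higher prime powers to the logarithmic derivative. -/
def primePowerSeries (n : ℤ) (s : ℂ) : ℂ :=
  ∑' q, (primeLog q : ℂ) * (heckeTerm n s q ^ 2 / (1 - heckeTerm n s q))

lemma summable_primeSeries (n : ℤ) {s : ℂ} (hs : 1 < s.re) :
    Summable fun q => (primeLog q : ℂ) * heckeTerm n s q := by
  refine Summable.of_norm_bounded (summable_logNorm_mul_exp hs) fun q => ?_
  rw [norm_mul, Complex.norm_real, Real.norm_of_nonneg (primeLog_nonneg q)]
  exact mul_le_mul (primeLog_le q) (norm_heckeTerm_le n s q) (norm_nonneg _) (logNorm_nonneg q)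

/-- Squares of primes already decay like `N(q)^{-2}` on `Re s = 1`, so the higher powers stay
harmless up to the boundary. -/
lemma norm_primePowerSeries_term_le (n : ℤ) {s : ℂ} (hs : 1 ≤ s.re) (q : GaussianInt) :
    ‖(primeLog q : ℂ) * (heckeTerm n s q ^ 2 / (1 - heckeTerm n s q))‖
      ≤ 2 * (logNorm q * Real.exp (-2 * logNorm q)) := by
  have hl := logNorm_nonneg q
  by_cases hq : Prime q
  · rw [norm_mul, Complex.norm_real, Real.norm_of_nonneg (primeLog_nonneg q), norm_div, norm_pow,
      mul_left_comm]
    refine mul_le_mul (primeLog_le q) ?_ (by positivity) hl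
    have h1 : 1 / 2 ≤ ‖1 - heckeTerm n s q‖ := by
      have h2 := norm_sub_norm_le (1 : ℂ) (heckeTerm n s q)
      rw [norm_one] at h2
      linarith [norm_heckeTerm_prime_le n hs hq]
    rw [div_le_iff₀ (by linarith)]
    have h3 : ‖heckeTerm n s q‖ ^ 2 ≤ Real.exp (-2 * logNorm q) := by
      have h4 : ‖heckeTerm n s q‖ ≤ Real.exp (-1 * logNorm q) :=
        (norm_heckeTerm_le n s q).trans (Real.exp_le_exp.2 (by nlinarith))
      refine (pow_le_pow_left₀ (norm_nonneg _) h4 2).trans (le_of_eq ?_)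
      rw [← Real.exp_nat_mul]; push_cast; ring_nf
    nlinarith [Real.exp_pos (-2 * logNorm q)]
  · simp only [primeLog_of_not_prime hq, Complex.ofReal_zero, zero_mul, norm_zero]
    positivity

lemma continuousOn_primePowerSeries (n : ℤ) :
    ContinuousOn (primePowerSeries n) {s | 1 ≤ s.re} := by
  refine continuousOn_tsum (fun q => ?_)
    ((summable_logNorm_mul_exp one_lt_two).mul_left 2)
    (fun q s hs => norm_primePowerSeries_term_le n hs q)
  by_cases hq : Prime q
  · have hc : Continuous fun s => heckeTerm n s q := by unfold heckeTerm; fun_prop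
    refine continuousOn_const.mul ((hc.pow 2).continuousOn.div
      (continuous_const.sub hc).continuousOn fun s hs h => ?_)
    have := norm_heckeTerm_prime_le n hs hq
    rw [← sub_eq_zero.1 h, norm_one] at this
    norm_num at this
  · simp only [primeLog_of_not_prime hq, Complex.ofReal_zero, zero_mul]
    exact continuousOn_const

/-- The logarithmic derivative of the Hecke L-series, without denominators. -/
theorem neg_four_mul_deriv_heckeL (n : ℤ) {s : ℂ} (hs : 1 < s.re) :
    -4 * deriv (heckeL n) s = heckeL n s * (primeSeries n s + primePowerSeries n s) := by
  -- Summing over `q` first produces `4 log N(ω)`, hence the derivative; summing over `ω` first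
  -- produces `t / (1 - t) = t + t² / (1 - t)` for each prime, with `t` its `heckeTerm`.
  set Φ : GaussianInt → GaussianInt → ℂ := fun ω q =>
    heckeTerm n s ω * ((primeLog q : ℂ) * (multiplicity q ω : ℂ)) with hΦ
  have hrow : ∀ ω, HasSum (fun q => Φ ω q) (heckeTerm n s ω * ((4 * logNorm ω : ℝ) : ℂ)) := by
    intro ω
    rcases eq_or_ne ω 0 with rfl | hω
    · simp [hΦ]
    · have := (Complex.hasSum_ofReal.2 (hasSum_primeLog_mul_multiplicity hω)).mul_left
        (heckeTerm n s ω)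
      simpa [hΦ] using this
  have hnrow : ∀ ω, HasSum (fun q => ‖Φ ω q‖) (‖heckeTerm n s ω‖ * (4 * logNorm ω)) := by
    intro ω
    have h1 : ∀ q, ‖Φ ω q‖ = ‖heckeTerm n s ω‖ * (primeLog q * (multiplicity q ω : ℝ)) := by
      intro q
      simp only [hΦ, norm_mul, Complex.norm_real, Complex.norm_natCast,
        Real.norm_of_nonneg (primeLog_nonneg q)]
    simp_rw [h1]
    rcases eq_or_ne ω 0 with rfl | hω
    · simp
    · exact (hasSum_primeLog_mul_multiplicity hω).mul_left _
  have hsum : Summable (Function.uncurry Φ) := by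
    refine Summable.of_norm ?_
    rw [summable_prod_of_nonneg fun _ => norm_nonneg _]
    refine ⟨fun ω => (hnrow ω).summable, ?_⟩
    have h1 : ∀ ω, ∑' q, ‖Function.uncurry Φ (ω, q)‖ = ‖heckeTerm n s ω‖ * (4 * logNorm ω) :=
      fun ω => (hnrow ω).tsum_eq
    simp_rw [h1]
    refine Summable.of_nonneg_of_le (fun ω => mul_nonneg (norm_nonneg _)
      (mul_nonneg (by norm_num) (logNorm_nonneg ω))) (fun ω => ?_)
      ((summable_logNorm_mul_exp hs).mul_left 4)
    have := mul_le_mul_of_nonneg_right (norm_heckeTerm_le n s ω)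
      (mul_nonneg (by norm_num : (0 : ℝ) ≤ 4) (logNorm_nonneg ω))
    linarith
  have hcomm := hsum.tsum_comm
  have hL : ∑' ω, ∑' q, Φ ω q = -4 * deriv (heckeL n) s := by
    rw [← (hasSum_deriv_heckeL n hs).2.tsum_eq, ← tsum_mul_left]
    congr 1 with ω
    rw [(hrow ω).tsum_eq]
    push_cast
    ring
  have hR : ∀ q, ∑' ω, Φ ω q = heckeL n s * ((primeLog q : ℂ) * heckeTerm n s q
      + (primeLog q : ℂ) * (heckeTerm n s q ^ 2 / (1 - heckeTerm n s q))) := by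
    intro q
    by_cases hq : Prime q
    · have ht1 : 1 - heckeTerm n s q ≠ 0 := by
        intro h
        have := norm_heckeTerm_prime_le n hs.le hq
        rw [← sub_eq_zero.1 h, norm_one] at this
        norm_num at this
      have h1 : ∀ ω, Φ ω q = (primeLog q : ℂ) * (heckeTerm n s ω * (multiplicity q ω : ℂ)) :=
        fun ω => by simp only [hΦ]; ring
      simp_rw [h1]
      rw [tsum_mul_left, tsum_heckeTerm_mul_multiplicity n hs hq]
      field_simp
      ring
    · simp [hΦ, primeLog_of_not_prime hq]
  have hpp : Summable fun q => (primeLog q : ℂ) * (heckeTerm n s q ^ 2 / (1 - heckeTerm n s q)) :=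
    Summable.of_norm_bounded ((summable_logNorm_mul_exp one_lt_two).mul_left 2)
      (norm_primePowerSeries_term_le n hs.le)
  rw [← hL, ← hcomm]
  simp_rw [hR]
  rw [tsum_mul_left, Summable.tsum_add (summable_primeSeries n hs) hpp]
  rfl

/-! ### Analytic continuation -/

/-- The order of the pole of `heckeL n` at `s = 1`. -/
def poleOrder (n : ℤ) : ℕ := if n = 0 then 1 else 0

/-- The error term in counting lattice points `ω` with `log N(ω) ≤ u`, weighted by `χ_n`. -/
def latticeError (n : ℤ) (u : ℝ) : ℂ :=
  summatory (fun ω => angChar n (GaussianInt.toComplex ω)) logNorm u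
    - poleOrder n * Real.pi * Complex.exp u

lemma logNorm_le_iff {ω : GaussianInt} (hω : ω ≠ 0) (u : ℝ) :
    logNorm ω ≤ u ↔ ω ∈ ball (Real.exp u) :=
  Real.log_le_iff_le_exp (by linarith [one_le_norm hω])

/-- Because `logNorm 0 = 0` is a default value, the condition `logNorm ω ≤ u` is meaningless at `ω =
0`; requiring `w 0 = 0` removes that point. -/
lemma summatory_logNorm {E : Type*} [AddCommMonoid E] [TopologicalSpace E] {w : GaussianInt → E}
    (hw : w 0 = 0) (u : ℝ) :
    summatory w logNorm u = ∑ ω ∈ (ball_finite (Real.exp u)).toFinset, w ω := by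
  rw [summatory, tsum_eq_sum (s := (ball_finite (Real.exp u)).toFinset)]
  · refine Finset.sum_congr rfl fun ω hω => ?_
    rcases eq_or_ne ω 0 with rfl | h0
    · simp [hw]
    · rw [if_pos ((logNorm_le_iff h0 u).2 ((Set.Finite.mem_toFinset _).1 hω))]
  · intro ω hω
    rcases eq_or_ne ω 0 with rfl | h0
    · simp [hw]
    · rw [if_neg fun h => hω ((Set.Finite.mem_toFinset _).2 ((logNorm_le_iff h0 u).1 h))]

/-- Taking `R = exp (u / 2)`, the error `R ^ (3/2)` becomes `exp (3 u / 4)`: this fixes the half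
plane of continuation. -/
lemma norm_latticeError_le (n : ℤ) : ∃ C : ℝ, ∀ u, 0 < u →
    ‖latticeError n u‖ ≤ C * Real.exp (3 / 4 * u) := by
  obtain ⟨C, hC⟩ := norm_sum_angChar_sub_le n
  refine ⟨C, fun u hu => ?_⟩
  have h1 := hC (Real.exp (u / 2)) (Real.one_le_exp (by linarith))
  have hexp : Real.exp (u / 2) ^ 2 = Real.exp u := by
    rw [← Real.exp_nat_mul]; push_cast; ring_nf
  have hsqrt : Real.exp (u / 2) * √(Real.exp (u / 2)) = Real.exp (3 / 4 * u) := by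
    rw [← Real.exp_half, ← Real.exp_add]; ring_nf
  rw [hsqrt] at h1
  simp only [hexp] at h1
  rw [latticeError, summatory_logNorm (by simp)]
  convert h1 using 3
  rw [poleOrder]
  split_ifs <;> simp

lemma measurable_latticeError (n : ℤ) : Measurable (latticeError n) := by
  unfold latticeError
  exact (measurable_summatory _ _).sub (by fun_prop)

/-- The Laplace transform of the error term. -/
def errorTransform (n : ℤ) (s : ℂ) : ℂ :=
  ∫ u in Ioi (0 : ℝ), latticeError n u * Complex.exp (-s * u)

lemma differentiableOn_errorTransform (n : ℤ) :
    DifferentiableOn ℂ (errorTransform n) {s | 3 / 4 < s.re} := by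
  obtain ⟨C, hC⟩ := norm_latticeError_le n
  exact differentiableOn_laplace (measurable_latticeError n) hC

/-- The analytic continuation of `(s - 1) ^ poleOrder n * heckeL n s`. -/
def heckeG (n : ℤ) (s : ℂ) : ℂ :=
  s * (poleOrder n * Real.pi + (s - 1) ^ poleOrder n * errorTransform n s)

lemma differentiableOn_heckeG (n : ℤ) : DifferentiableOn ℂ (heckeG n) {s | 3 / 4 < s.re} := by
  have := differentiableOn_errorTransform n
  unfold heckeG
  fun_prop

lemma heckeL_eq (n : ℤ) {s : ℂ} (hs : 1 < s.re) :
    heckeL n s = s * (poleOrder n * Real.pi / (s - 1) + errorTransform n s) := by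
  have hs0 : 0 < s.re := by linarith
  have hs1 : 0 < (s - 1).re := by simpa using hs
  obtain ⟨h1, h2⟩ := laplace_summatory (w := fun ω => angChar n (GaussianInt.toComplex ω))
    (ℓ := logNorm) logNorm_nonneg hs0
    ((summable_exp_neg_mul_logNorm hs).of_nonneg_of_le (fun ω => by positivity) fun ω =>
      mul_le_of_le_one_left (Real.exp_pos _).le (norm_angChar_le n _))
  have h3 : heckeL n s = s * ∫ u in Ioi (0 : ℝ),
      summatory (fun ω => angChar n (GaussianInt.toComplex ω)) logNorm u * Complex.exp (-s * u) := h2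
  have h4 : ∀ u : ℝ, latticeError n u * Complex.exp (-s * u)
      = summatory (fun ω => angChar n (GaussianInt.toComplex ω)) logNorm u * Complex.exp (-s * u)
        - poleOrder n * Real.pi * Complex.exp (-(s - 1) * u) := by
    intro u
    have : Complex.exp (-(s - 1) * u) = Complex.exp u * Complex.exp (-s * u) := by
      rw [← Complex.exp_add]; ring_nf
    rw [this, latticeError]; ring
  have h5 : ∫ u in Ioi (0 : ℝ), Complex.exp (-(s - 1) * u) = 1 / (s - 1) := by
    rw [integral_exp_mul_complex_Ioi (by simpa using hs)]
    simp
    grind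
  have h6 : errorTransform n s = (∫ u in Ioi (0 : ℝ),
      summatory (fun ω => angChar n (GaussianInt.toComplex ω)) logNorm u * Complex.exp (-s * u))
      - poleOrder n * Real.pi / (s - 1) := by
    rw [errorTransform]
    simp_rw [h4]
    rw [integral_sub h1 ((integrableOn_cexp_neg_mul hs1 0).const_mul _), integral_const_mul, h5]
    ring
  rw [h3, h6]
  ring

lemma heckeG_eq (n : ℤ) {s : ℂ} (hs : 1 < s.re) :
    heckeG n s = (s - 1) ^ poleOrder n * heckeL n s := by
  have hs1 : s - 1 ≠ 0 := by
    intro h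
    rw [sub_eq_zero.1 h] at hs
    simp at hs
  rw [heckeL_eq n hs, heckeG]
  unfold poleOrder
  split_ifs
  · simp; field_simp
  · simp

lemma heckeG_zero_one : heckeG 0 1 = Real.pi := by
  simp [heckeG, poleOrder]

/-- Multiplied out by `heckeG n s`, so that it can be used before nonvanishing is known. -/
lemma logDeriv_heckeG (n : ℤ) {s : ℂ} (hs : 1 < s.re) :
    4 * deriv (heckeG n) s
      = heckeG n s * (4 * poleOrder n / (s - 1) - primeSeries n s - primePowerSeries n s) := by
  have hs1 : s - 1 ≠ 0 := by
    intro h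
    rw [sub_eq_zero.1 h] at hs
    simp at hs
  have hev : heckeG n =ᶠ[𝓝 s] fun z => (z - 1) ^ poleOrder n * heckeL n z := by
    filter_upwards [(isOpen_re_gt 1).mem_nhds hs] with z hz using heckeG_eq n hz
  have hL := (hasSum_deriv_heckeL n hs).1.hasDerivAt
  have hid := neg_four_mul_deriv_heckeL n hs
  rw [hev.deriv_eq, heckeG_eq n hs]
  unfold poleOrder
  split_ifs
  · have h1 : HasDerivAt (fun z => (z - 1) ^ 1 * heckeL n z)
        (1 * heckeL n s + (s - 1) * deriv (heckeL n) s) s := by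
      simp only [pow_one]
      exact ((hasDerivAt_id s).sub_const 1).mul hL
    rw [h1.deriv]
    field_simp
    push_cast
    linear_combination (-(s - 1)) * hid
  · simp only [pow_zero, one_mul, Nat.cast_zero, mul_zero, zero_div, zero_sub]
    linear_combination -hid

/-! ### Nonvanishing on `Re s ≥ 1` -/

lemma angChar_of_mem_gaussUnits {n : ℤ} (hn : 4 ∣ n) {u : GaussianInt} (hu : u ∈ gaussUnits) :
    angChar n (GaussianInt.toComplex u) = 1 := by
  obtain ⟨k, rfl⟩ := hn
  have hu0 : GaussianInt.toComplex u ≠ 0 := by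
    simpa using (mem_gaussUnits_iff.1 hu).ne_zero
  rw [angChar_of_ne hu0, zpow_mul]
  simp only [gaussUnits, Finset.mem_insert, Finset.mem_singleton] at hu
  have h4 : (GaussianInt.toComplex u / ‖GaussianInt.toComplex u‖) ^ (4 : ℤ) = 1 := by
    rcases hu with rfl | rfl | rfl | rfl <;> simp [GaussianInt.toComplex_def] <;> norm_cast
    rw [Even.neg_pow (by decide)]
    exact Complex.I_pow_four
  rw [h4, one_zpow]

/-- Only the elements of norm 1 survive, and the character is 1 at each of the four units. The
nonzero limit shows that `heckeG n` is not identically zero. -/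
lemma tendsto_heckeL_atTop {n : ℤ} (hn : 4 ∣ n) :
    Tendsto (fun σ : ℝ => heckeL n σ) atTop (𝓝 4) := by
  have hlim : ∑' ω : GaussianInt, (if ω ∈ gaussUnits then (1 : ℂ) else 0) = 4 := by
    rw [tsum_eq_sum (s := gaussUnits) fun ω hω => if_neg hω]
    rw [Finset.sum_congr rfl fun ω hω => if_pos hω]
    simp [card_gaussUnits]
  rw [← hlim]
  refine tendsto_tsum_of_dominated_convergence (summable_exp_neg_mul_logNorm one_lt_two)
    (fun ω => ?_) ?_
  · split_ifs with h
    · refine tendsto_const_nhds.congr fun σ => ?_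
      rw [heckeTerm, angChar_of_mem_gaussUnits hn h, logNorm_of_isUnit (mem_gaussUnits_iff.1 h)]
      simp
    · rcases eq_or_ne ω 0 with rfl | h0
      · simp
      · have hpos : 0 < logNorm ω := by
          refine Real.log_pos (lt_of_le_of_ne (one_le_norm h0) fun h1 => h ?_)
          rw [mem_gaussUnits_iff, ← norm_eq_one_iff_isUnit]
          exact_mod_cast h1.symm
        rw [tendsto_zero_iff_norm_tendsto_zero]
        simp_rw [norm_heckeTerm n _ h0, Complex.ofReal_re]
        refine Real.tendsto_exp_atBot.comp ?_
        exact tendsto_neg_atTop_atBot.atBot_mul_const hpos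
  · filter_upwards [eventually_ge_atTop 2] with σ hσ ω
    refine (norm_heckeTerm_le n _ ω).trans (Real.exp_le_exp.2 ?_)
    have := logNorm_nonneg ω
    rw [Complex.ofReal_re]
    nlinarith

lemma not_eventually_heckeG_eq_zero {n : ℤ} (hn : 4 ∣ n) {s : ℂ} (hs : 3 / 4 < s.re) :
    ¬ ∀ᶠ z in 𝓝 s, heckeG n z = 0 := by
  intro h
  have han : AnalyticOnNhd ℂ (heckeG n) {s | 3 / 4 < s.re} :=
    (differentiableOn_heckeG n).analyticOnNhd (isOpen_re_gt _)
  have hpre : IsPreconnected {s : ℂ | 3 / 4 < s.re} := (convex_halfSpace_re_gt _).isPreconnected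
  have hzero := han.eqOn_zero_of_preconnected_of_eventuallyEq_zero hpre hs h
  have hL := (tendsto_heckeL_atTop hn).eventually_ne (show (4 : ℂ) ≠ 0 by norm_num)
  obtain ⟨σ, hσ, hσ1⟩ := (hL.and (eventually_gt_atTop 1)).exists
  have hre : 1 < (σ : ℂ).re := by simpa using hσ1
  have h1 := hzero (show (σ : ℂ) ∈ {s : ℂ | 3 / 4 < s.re} by
    simp only [mem_ofPred_eq]; linarith)
  rw [heckeG_eq n hre] at h1
  refine (mul_ne_zero (pow_ne_zero _ ?_) hσ) h1
  intro h2
  rw [sub_eq_zero.1 h2] at hre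
  simp at hre

/-- The residue of the logarithmic derivative at a zero is its multiplicity. -/
lemma tendsto_sub_mul_logDeriv {f : ℂ → ℂ} {z₀ : ℂ} (hf : AnalyticAt ℂ f z₀)
    (h0 : ¬ ∀ᶠ z in 𝓝 z₀, f z = 0) :
    ∃ m : ℕ, (f z₀ = 0 ↔ m ≠ 0) ∧ (∀ᶠ z in 𝓝[≠] z₀, f z ≠ 0) ∧
      Tendsto (fun z => (z - z₀) * (deriv f z / f z)) (𝓝[≠] z₀) (𝓝 m) := by
  obtain ⟨m, g, hg, hg0, hfg⟩ := hf.exists_eventuallyEq_pow_smul_nonzero_iff.2 h0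
  have hgne : ∀ᶠ z in 𝓝 z₀, g z ≠ 0 := hg.continuousAt.eventually_ne hg0
  have hne : ∀ᶠ z in 𝓝[≠] z₀, f z ≠ 0 := by
    filter_upwards [hfg.filter_mono nhdsWithin_le_nhds, hgne.filter_mono nhdsWithin_le_nhds,
      self_mem_nhdsWithin] with z h1 h2 h3
    rw [h1]
    exact smul_ne_zero (pow_ne_zero _ (sub_ne_zero.2 h3)) h2
  refine ⟨m, ?_, hne, ?_⟩
  · rw [hfg.self_of_nhds]
    simp [hg0]
  · have hlim : Tendsto (fun z => (m : ℂ) + (z - z₀) * (deriv g z / g z)) (𝓝[≠] z₀) (𝓝 m) := by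
      have hc : ContinuousAt (fun z => (m : ℂ) + (z - z₀) * (deriv g z / g z)) z₀ :=
        continuousAt_const.add ((continuousAt_id.sub continuousAt_const).mul
          (hg.deriv.continuousAt.div hg.continuousAt hg0))
      have := hc.tendsto
      simp only [sub_self, zero_mul, add_zero] at this
      exact this.mono_left nhdsWithin_le_nhds
    refine hlim.congr' ?_
    have hev : ∀ᶠ z in 𝓝 z₀, f =ᶠ[𝓝 z] fun z => (z - z₀) ^ m • g z :=
      eventually_eventually_nhds.2 hfg
    filter_upwards [hev.filter_mono nhdsWithin_le_nhds, hgne.filter_mono nhdsWithin_le_nhds,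
      hg.eventually_analyticAt.filter_mono nhdsWithin_le_nhds, self_mem_nhdsWithin]
      with z h1 h2 h3 h4
    have hz : z - z₀ ≠ 0 := sub_ne_zero.2 h4
    have hd : HasDerivAt (fun z => (z - z₀) ^ m • g z)
        ((m * (z - z₀) ^ (m - 1) * 1) * g z + (z - z₀) ^ m * deriv g z) z :=
      (((hasDerivAt_id z).sub_const z₀).pow m).mul h3.differentiableAt.hasDerivAt
    rw [h1.deriv_eq, hd.deriv, h1.self_of_nhds]
    simp only [smul_eq_mul]
    rcases m with _ | m
    · simp
    · rw [Nat.add_sub_cancel]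
      field_simp
      ring

lemma tendsto_ofReal_nhdsNE (s : ℂ) :
    Tendsto (fun ε : ℝ => s + ε) (𝓝[>] 0) (𝓝[≠] s) := by
  refine tendsto_nhdsWithin_iff.2 ⟨?_, ?_⟩
  · have : Continuous fun ε : ℝ => s + ε := by fun_prop
    simpa using (this.tendsto 0).mono_left nhdsWithin_le_nhds
  · filter_upwards [self_mem_nhdsWithin] with ε hε
    simp [(mem_Ioi.1 hε).ne']

/-- The boundary behaviour of `primeSeries n` is governed by the order of vanishing of `heckeG n`. -/
lemma tendsto_mul_primeSeries {n : ℤ} (hn : 4 ∣ n) {s : ℂ} (hs : 1 ≤ s.re) :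
    ∃ m : ℕ, (heckeG n s = 0 ↔ m ≠ 0) ∧
      Tendsto (fun ε : ℝ => (ε : ℂ) * primeSeries n (s + ε)) (𝓝[>] 0)
        (𝓝 (4 * ((if n = 0 ∧ s = 1 then 1 else 0) - m))) := by
  have hs' : 3 / 4 < s.re := by linarith
  obtain ⟨m, hm, hne, hlim⟩ := tendsto_sub_mul_logDeriv
    ((differentiableOn_heckeG n).analyticAt ((isOpen_re_gt _).mem_nhds hs'))
    (not_eventually_heckeG_eq_zero hn hs')
  refine ⟨m, hm, ?_⟩
  have hlim' := hlim.comp (tendsto_ofReal_nhdsNE s)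
  have hne' := (tendsto_ofReal_nhdsNE s).eventually hne
  have hpole : Tendsto (fun ε : ℝ => (ε : ℂ) * (poleOrder n / (s + ε - 1))) (𝓝[>] 0)
      (𝓝 (if n = 0 ∧ s = 1 then 1 else 0)) := by
    by_cases hn0 : n = 0
    · by_cases hs1 : s = 1
      · rw [if_pos ⟨hn0, hs1⟩]
        refine tendsto_const_nhds.congr' ?_
        filter_upwards [self_mem_nhdsWithin] with ε hε
        have : (ε : ℂ) ≠ 0 := by exact_mod_cast (mem_Ioi.1 hε).ne'
        simp [hs1, hn0, poleOrder, this]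
      · rw [if_neg (by tauto)]
        have hc : ContinuousAt (fun ε : ℝ => (ε : ℂ) * (poleOrder n / (s + ε - 1))) 0 := by
          refine ContinuousAt.mul (by fun_prop) (ContinuousAt.div (by fun_prop) (by fun_prop) ?_)
          simpa using sub_ne_zero.2 hs1
        simpa using hc.tendsto.mono_left nhdsWithin_le_nhds
    · rw [if_neg (by tauto)]
      simp [poleOrder, hn0]
  have hpp : Tendsto (fun ε : ℝ => (ε : ℂ) * primePowerSeries n (s + ε)) (𝓝[>] 0) (𝓝 0) := by
    have h1 : Tendsto (fun ε : ℝ => s + ε) (𝓝[>] 0) (𝓝[{s | 1 ≤ s.re}] s) := by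
      refine tendsto_nhdsWithin_iff.2 ⟨(tendsto_ofReal_nhdsNE s).mono_right nhdsWithin_le_nhds, ?_⟩
      filter_upwards [self_mem_nhdsWithin] with ε hε
      have := mem_Ioi.1 hε
      simp only [Complex.add_re, Complex.ofReal_re]
      linarith
    have h2 := (continuousOn_primePowerSeries n s hs).tendsto.comp h1
    have h3 : Tendsto (fun ε : ℝ => (ε : ℂ)) (𝓝[>] 0) (𝓝 0) := by
      simpa using (Complex.continuous_ofReal.tendsto 0).mono_left nhdsWithin_le_nhds
    simpa using h3.mul h2
  have key := (((hpole.sub hlim').const_mul 4).sub hpp)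
  rw [sub_zero] at key
  refine key.congr' ?_
  filter_upwards [hne', self_mem_nhdsWithin] with ε h1 hε
  have hε := mem_Ioi.1 hε
  have h2 := logDeriv_heckeG n (s := s + ε) (by
    simp only [Complex.add_re, Complex.ofReal_re]; linarith)
  simp only [Function.comp, add_sub_cancel_left]
  have h3 : deriv (heckeG n) (s + ε) / heckeG n (s + ε)
      = (4 * poleOrder n / (s + ε - 1) - primeSeries n (s + ε) - primePowerSeries n (s + ε)) / 4 := by
    rw [div_eq_div_iff h1 (by norm_num)]
    linear_combination h2
  rw [h3]
  ring

lemma norm_primeSeries_le (n : ℤ) {a : ℝ} (ha : 1 < a) {s : ℂ} (hs : a ≤ s.re) :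
    ‖primeSeries n s‖ ≤ ∑' q, logNorm q * Real.exp (-a * logNorm q) := by
  refine tsum_of_norm_bounded (summable_logNorm_mul_exp ha).hasSum fun q => ?_
  rw [norm_mul, Complex.norm_real, Real.norm_of_nonneg (primeLog_nonneg q)]
  refine mul_le_mul (primeLog_le q) ((norm_heckeTerm_le n s q).trans (Real.exp_le_exp.2 ?_))
    (norm_nonneg _) (logNorm_nonneg q)
  have := logNorm_nonneg q
  nlinarith

/-- A zero of order `m` would force `primeSeries n` to behave like `-4 m / ε` to the right of `s`,
where it is bounded by absolute convergence. -/
lemma heckeG_ne_zero_of_one_lt {n : ℤ} (hn : 4 ∣ n) {s : ℂ} (hs : 1 < s.re) : heckeG n s ≠ 0 := by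
  obtain ⟨m, hm, hlim⟩ := tendsto_mul_primeSeries hn hs.le
  have h1 : Tendsto (fun ε : ℝ => (ε : ℂ) * primeSeries n (s + ε)) (𝓝[>] 0) (𝓝 0) := by
    have h3 : Tendsto (fun ε : ℝ => (ε : ℂ)) (𝓝[>] 0) (𝓝 0) := by
      simpa using (Complex.continuous_ofReal.tendsto 0).mono_left nhdsWithin_le_nhds
    refine h3.zero_mul_isBoundedUnder_le ?_
    refine isBoundedUnder_of_eventually_le (a := ∑' q, logNorm q * Real.exp (-s.re * logNorm q)) ?_
    filter_upwards [self_mem_nhdsWithin] with ε hε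
    have := mem_Ioi.1 hε
    exact norm_primeSeries_le n hs (by simp only [Complex.add_re, Complex.ofReal_re]; linarith)
  have h2 := tendsto_nhds_unique h1 hlim
  have hs1 : s ≠ 1 := by rintro rfl; simp at hs
  rw [if_neg (by tauto)] at h2
  intro h
  exact hm.1 h (by simpa using h2)

lemma angChar_two_mul (n : ℤ) (z : ℂ) : angChar (2 * n) z = angChar n z ^ 2 := by
  rcases eq_or_ne z 0 with rfl | hz
  · simp
  · rw [angChar_of_ne hz, angChar_of_ne hz, mul_comm, zpow_mul]
    norm_cast

/-- The inequality `3 + 4 cos θ + cos 2θ ≥ 0` for Dirichlet series over primes. -/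
lemma three_four_one (n : ℤ) {σ : ℝ} (hσ : 1 < σ) (t : ℝ) :
    0 ≤ 3 * (primeSeries 0 σ).re + 4 * (primeSeries n (σ + t * Complex.I)).re
      + (primeSeries (2 * n) (σ + 2 * t * Complex.I)).re := by
  have s0 := Complex.hasSum_re (summable_primeSeries 0 (s := σ) (by simpa)).hasSum
  have s1 := Complex.hasSum_re
    (summable_primeSeries n (s := σ + t * Complex.I) (by simpa)).hasSum
  have s2 := Complex.hasSum_re
    (summable_primeSeries (2 * n) (s := σ + 2 * t * Complex.I) (by simpa)).hasSum
  refine ((s0.mul_left 3).add (s1.mul_left 4) |>.add s2).nonneg fun q => ?_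
  by_cases hq : Prime q
  · have hq0 : GaussianInt.toComplex q ≠ 0 := by simpa using hq.ne_zero
    set e : ℂ := angChar n (GaussianInt.toComplex q) * Complex.exp (-(t * Complex.I) * logNorm q)
      with he
    set r : ℝ := Real.exp (-σ * logNorm q) with hr
    have hrc : (r : ℂ) = Complex.exp (-σ * logNorm q) := by rw [hr]; push_cast; rfl
    have e0 : heckeTerm 0 σ q = r := by
      rw [heckeTerm, angChar_zero_left hq0, hrc, one_mul]
    have e1 : heckeTerm n (σ + t * Complex.I) q = r * e := by
      rw [heckeTerm, hrc, he, mul_left_comm, ← Complex.exp_add]; ring_nf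
    have e2 : heckeTerm (2 * n) (σ + 2 * t * Complex.I) q = r * e ^ 2 := by
      rw [heckeTerm, hrc, he, angChar_two_mul, mul_pow, mul_left_comm, ← Complex.exp_nat_mul,
        ← Complex.exp_add]
      push_cast; ring_nf
    have hnorm : ‖e‖ = 1 := by
      rw [he, norm_mul, norm_angChar hq0, Complex.norm_exp]; simp
    have hsq : e.re ^ 2 + e.im ^ 2 = 1 := by
      rw [← one_pow 2, ← hnorm, Complex.sq_norm, Complex.normSq_apply]; ring
    have hre2 : (e ^ 2).re = 2 * e.re ^ 2 - 1 := by
      rw [pow_two, Complex.mul_re]; linarith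
    rw [e0, e1, e2, Complex.re_ofReal_mul, Complex.re_ofReal_mul, Complex.re_ofReal_mul,
      Complex.re_ofReal_mul, Complex.re_ofReal_mul, hre2, Complex.ofReal_re]
    have hpos : 0 ≤ primeLog q * r := mul_nonneg (primeLog_nonneg q) (Real.exp_pos _).le
    have : 3 * (primeLog q * r) + 4 * (primeLog q * (r * e.re))
        + primeLog q * (r * (2 * e.re ^ 2 - 1)) = primeLog q * r * (2 * (1 + e.re) ^ 2) := by ring
    rw [this]
    positivity
  · simp [primeLog_of_not_prime hq]

/-- The 3-4-1 argument. Multiply `three_four_one` at `σ = 1 + ε` by `ε` and let `ε → 0`: the pole of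
the trivial character gives 12, while zeros of order `m1` at `1 + i t` and `m2` at `1 + 2 i t` give
`-16 m1 - 4 m2`. Nonnegativity forces `m1 = 0`. -/
theorem heckeG_ne_zero {n : ℤ} (hn : 4 ∣ n) {s : ℂ} (hs : 1 ≤ s.re) : heckeG n s ≠ 0 := by
  rcases hs.lt_or_eq with hs1 | hs1
  · exact heckeG_ne_zero_of_one_lt hn hs1
  by_cases hex : n = 0 ∧ s = 1
  · rw [hex.1, hex.2, heckeG_zero_one]
    exact_mod_cast Real.pi_ne_zero
  obtain ⟨t, rfl⟩ : ∃ t : ℝ, s = 1 + t * Complex.I :=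
    ⟨s.im, by rw [← Complex.re_add_im s, ← hs1]; simp⟩
  -- The third series must have no pole; this includes the case `n = 0`, `t ≠ 0`.
  have hex2 : ¬ (2 * n = 0 ∧ (1 : ℂ) + 2 * t * Complex.I = 1) := by
    rintro ⟨h1, h2⟩
    refine hex ⟨by omega, ?_⟩
    have h3 : (2 : ℂ) * (t * Complex.I) = 0 := by linear_combination h2
    have h4 := (mul_eq_zero.1 h3).resolve_left two_ne_zero
    rw [h4, add_zero]
  obtain ⟨m0, hm0, hl0⟩ := tendsto_mul_primeSeries (dvd_zero 4) (s := 1) (by simp)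
  obtain ⟨m1, hm1, hl1⟩ := tendsto_mul_primeSeries hn (s := 1 + t * Complex.I) (by simp)
  obtain ⟨m2, hm2, hl2⟩ := tendsto_mul_primeSeries (hn.mul_left 2) (s := 1 + 2 * t * Complex.I)
    (by simp)
  have hm0' : m0 = 0 := by
    by_contra h
    have := hm0.2 h
    rw [heckeG_zero_one] at this
    exact Real.pi_ne_zero (by exact_mod_cast this)
  subst hm0'
  rw [if_neg hex] at hl1
  rw [if_neg hex2] at hl2
  rw [if_pos ⟨rfl, rfl⟩] at hl0
  have r0 := (Complex.continuous_re.tendsto _).comp hl0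
  have r1 := (Complex.continuous_re.tendsto _).comp hl1
  have r2 := (Complex.continuous_re.tendsto _).comp hl2
  have key := ((r0.const_mul 3).add (r1.const_mul 4)).add r2
  have hnn := ge_of_tendsto key (b := 0) (by
    filter_upwards [self_mem_nhdsWithin] with ε hε
    have hε := mem_Ioi.1 hε
    have h1 := three_four_one n (σ := 1 + ε) (by linarith) t
    simp only [Function.comp, Complex.re_ofReal_mul]
    have e1 : ((1 + ε : ℝ) : ℂ) = 1 + ε := by push_cast; rfl
    have e2 : ((1 + ε : ℝ) : ℂ) + t * Complex.I = 1 + t * Complex.I + ε := by push_cast; ring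
    have e3 : ((1 + ε : ℝ) : ℂ) + 2 * t * Complex.I = 1 + 2 * t * Complex.I + ε := by
      push_cast; ring
    rw [e2, e3, e1] at h1
    have := mul_nonneg hε.le h1
    linarith)
  have hval : (3 : ℝ) * (4 * ((1 : ℂ) - ((0 : ℕ) : ℂ))).re + 4 * (4 * ((0 : ℂ) - (m1 : ℂ))).re
      + (4 * ((0 : ℂ) - (m2 : ℂ))).re = 12 - 16 * m1 - 4 * m2 := by
    simp; ring
  rw [hval] at hnn
  intro h
  have h1 : 1 ≤ m1 := Nat.one_le_iff_ne_zero.2 (hm1.1 h)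
  have h2 : (1 : ℝ) ≤ m1 := by exact_mod_cast h1
  have h3 : (0 : ℝ) ≤ m2 := Nat.cast_nonneg _
  linarith

/-- The prime series `primeSeries n` extends continuously to `Re s ≥ 1` apart from the pole. -/
theorem exists_continuousOn_primeSeries {n : ℤ} (hn : 4 ∣ n) :
    ∃ R : ℂ → ℂ, ContinuousOn R {s | 1 ≤ s.re} ∧
      ∀ s : ℂ, 1 < s.re → primeSeries n s = 4 * poleOrder n / (s - 1) + R s := by
  have hsub : {s : ℂ | 1 ≤ s.re} ⊆ {s : ℂ | 3 / 4 < s.re} := fun s hs => by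
    have : 1 ≤ s.re := hs
    simp only [mem_ofPred_eq]; linarith
  refine ⟨fun s => -(4 * (deriv (heckeG n) s / heckeG n s)) - primePowerSeries n s, ?_, ?_⟩
  · have han : AnalyticOnNhd ℂ (heckeG n) {s | 3 / 4 < s.re} :=
      (differentiableOn_heckeG n).analyticOnNhd (isOpen_re_gt _)
    exact (((han.deriv.continuousOn.mono hsub).div (han.continuousOn.mono hsub)
      fun s hs => heckeG_ne_zero hn hs).const_mul 4 |>.neg).sub (continuousOn_primePowerSeries n)
  · intro s hs
    have h1 := heckeG_ne_zero hn hs.le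
    have h2 := logDeriv_heckeG n hs
    have h3 : 4 * (deriv (heckeG n) s / heckeG n s)
        = 4 * poleOrder n / (s - 1) - primeSeries n s - primePowerSeries n s := by
      rw [← mul_div_assoc, h2, mul_div_cancel_left₀ _ h1]
    simp only [h3]
    ring

/-! ### Weyl sums over Gaussian primes -/

lemma conj_angChar (n : ℤ) (z : ℂ) : starRingEnd ℂ (angChar n z) = angChar (-n) z := by
  rcases eq_or_ne z 0 with rfl | hz
  · simp
  rw [angChar_of_ne hz, angChar_of_ne hz, map_zpow₀, zpow_neg, ← inv_zpow]
  congr 1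
  rw [Complex.inv_def, Complex.normSq_eq_norm_sq, norm_div_norm hz]
  simp

lemma tendsto_sum_primeLog_mul {w : GaussianInt → ℝ} {c : ℝ}
    (h : Tendsto (fun u => summatory (fun q => primeLog q * w q) logNorm u * Real.exp (-u)) atTop
      (𝓝 c)) :
    Tendsto (fun x => (∑ q ∈ (ball_finite x).toFinset, primeLog q * w q) / x) atTop (𝓝 c) := by
  have h0 : primeLog 0 = 0 := primeLog_of_not_prime not_prime_zero
  refine (h.comp Real.tendsto_log_atTop).congr' ?_
  filter_upwards [eventually_gt_atTop 0] with x hx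
  simp only [Function.comp]
  rw [summatory_logNorm (by simp [h0]), Real.exp_neg, Real.exp_log hx, div_eq_mul_inv]

/-- The prime number theorem for `ℤ[i]` with weights `log N(q) (1 + Re (c χ_n(q)))`. -/
lemma tendsto_sum_primeLog_mul_one_add_re {n : ℤ} (hn : 4 ∣ n) (hn0 : n ≠ 0) {c : ℂ}
    (hc : ‖c‖ ≤ 1) :
    Tendsto (fun x => (∑ q ∈ (ball_finite x).toFinset,
      primeLog q * (1 + (c * angChar n (GaussianInt.toComplex q)).re)) / x) atTop (𝓝 4) := by
  have hre : ∀ q, |(c * angChar n (GaussianInt.toComplex q)).re| ≤ 1 := fun q =>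
    (Complex.abs_re_le_norm _).trans (by
      rw [norm_mul]; exact mul_le_one₀ hc (norm_nonneg _) (norm_angChar_le _ _))
  obtain ⟨R0, hR0, h0⟩ := exists_continuousOn_primeSeries (dvd_zero 4)
  obtain ⟨R1, hR1, h1⟩ := exists_continuousOn_primeSeries hn
  obtain ⟨R2, hR2, h2⟩ := exists_continuousOn_primeSeries (n := -n) (by simpa using hn)
  -- `Re (c χ_n)` is the mean of `c χ_n` and its conjugate, which involves `χ_{-n}`. Since `n ≠ 0`,
  -- only the constant 1 contributes a pole, and `‖c‖ ≤ 1` keeps the weights nonnegative.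
  refine tendsto_sum_primeLog_mul (tendsto_summatory_mul_exp_neg (fun q => ?_) logNorm_nonneg
    (fun σ hσ => ?_) (by norm_num)
    (R := fun s => R0 s + (c / 2 * R1 s + starRingEnd ℂ c / 2 * R2 s)) ?_ fun s hs => ?_)
  · exact mul_nonneg (primeLog_nonneg q) (by linarith [(abs_le.1 (hre q)).1])
  · refine Summable.of_nonneg_of_le (fun q => ?_) (fun q => ?_)
      ((summable_logNorm_mul_exp hσ).mul_left 2)
    · exact mul_nonneg (mul_nonneg (primeLog_nonneg q) (by linarith [(abs_le.1 (hre q)).1]))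
        (Real.exp_pos _).le
    · rw [← mul_assoc]
      refine mul_le_mul_of_nonneg_right ?_ (Real.exp_pos _).le
      rw [mul_comm 2]
      exact mul_le_mul (primeLog_le q) (by linarith [(abs_le.1 (hre q)).2])
        (by linarith [(abs_le.1 (hre q)).1]) (logNorm_nonneg q)
  · fun_prop
  · have hterm : ∀ q, ((primeLog q * (1 + (c * angChar n (GaussianInt.toComplex q)).re) : ℝ) : ℂ)
        * Complex.exp (-s * logNorm q)
        = primeLog q * heckeTerm 0 s q + (c / 2 * (primeLog q * heckeTerm n s q)
          + starRingEnd ℂ c / 2 * (primeLog q * heckeTerm (-n) s q)) := by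
      intro q
      by_cases hq : Prime q
      · have hq0 : GaussianInt.toComplex q ≠ 0 := by simpa using hq.ne_zero
        rw [heckeTerm, heckeTerm, heckeTerm, angChar_zero_left hq0, ← conj_angChar]
        push_cast
        rw [Complex.re_eq_add_conj, map_mul]
        ring
      · simp [primeLog_of_not_prime hq]
    simp_rw [hterm]
    have s0 := summable_primeSeries 0 hs
    have s1 := (summable_primeSeries n hs).mul_left (c / 2)
    have s2 := (summable_primeSeries (-n) hs).mul_left (starRingEnd ℂ c / 2)
    rw [s0.tsum_add (s1.add s2), s1.tsum_add s2, tsum_mul_left, tsum_mul_left]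
    change primeSeries 0 s + (c / 2 * primeSeries n s + starRingEnd ℂ c / 2 * primeSeries (-n) s) = _
    rw [h0 s hs, h1 s hs, h2 s hs]
    simp [poleOrder, hn0]
    ring

/-- The prime number theorem for `ℤ[i]` in Chebyshev form. -/
theorem tendsto_sum_primeLog :
    Tendsto (fun x => (∑ q ∈ (ball_finite x).toFinset, primeLog q) / x) atTop (𝓝 4) := by
  have := tendsto_sum_primeLog_mul_one_add_re (dvd_refl 4) (by norm_num) (c := 0) (by simp)
  simpa using this

lemma I_zpow_ne_one {n : ℤ} (hn : ¬ 4 ∣ n) : Complex.I ^ n ≠ 1 := by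
  have h1 : Complex.I ^ n = Complex.I ^ (n % 4) := by
    conv_lhs => rw [← Int.emod_add_mul_ediv n 4]
    rw [zpow_add₀ Complex.I_ne_zero, zpow_mul]
    have : Complex.I ^ (4 : ℤ) = 1 := by norm_cast; exact Complex.I_pow_four
    rw [this, one_zpow, mul_one]
  have h2 : n % 4 = 1 ∨ n % 4 = 2 ∨ n % 4 = 3 := by omega
  rw [h1]
  have hI : Complex.I ≠ 1 := fun h => by simpa using congrArg Complex.re h
  rcases h2 with h | h | h <;> rw [h]
  · simpa using hI
  · norm_cast
    rw [Complex.I_sq]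
    norm_num
  · norm_cast
    rw [Complex.I_pow_three]
    intro h
    simpa using congrArg Complex.re h

/-- The Weyl sums with exponent not divisible by `4` vanish because of the units of `ℤ[i]`. -/
lemma sum_primeLog_mul_angChar_eq_zero {n : ℤ} (hn : ¬ 4 ∣ n) (x : ℝ) :
    ∑ q ∈ (ball_finite x).toFinset, (primeLog q : ℂ) * angChar n (GaussianInt.toComplex q) = 0 := by
  set i : GaussianInt := ⟨0, 1⟩ with hi
  have hiu : IsUnit i := mem_gaussUnits_iff.1 (by decide)
  have hic : GaussianInt.toComplex i = Complex.I := by simp [hi, GaussianInt.toComplex_def]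
  have hnorm : ∀ q, Zsqrtd.norm (i * q) = Zsqrtd.norm q := fun q => by
    rw [Zsqrtd.norm_mul, (norm_eq_one_iff_isUnit i).2 hiu, one_mul]
  have hlog : ∀ q, primeLog (i * q) = primeLog q := by
    intro q
    have : Prime (i * q) ↔ Prime q :=
      (associated_unit_mul_left q i hiu).prime_iff
    by_cases hq : Prime q
    · rw [primeLog_of_prime hq, primeLog_of_prime (this.2 hq), logNorm, logNorm, hnorm]
    · rw [primeLog_of_not_prime hq, primeLog_of_not_prime fun h => hq (this.1 h)]
  have hchar : ∀ q : GaussianInt, angChar n (GaussianInt.toComplex (i * q))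
      = Complex.I ^ n * angChar n (GaussianInt.toComplex q) := by
    intro q
    rw [map_mul, angChar_mul, hic, angChar_of_ne Complex.I_ne_zero]
    simp
  have key : ∑ q ∈ (ball_finite x).toFinset, (primeLog q : ℂ) * angChar n (GaussianInt.toComplex q)
      = Complex.I ^ n * ∑ q ∈ (ball_finite x).toFinset,
        (primeLog q : ℂ) * angChar n (GaussianInt.toComplex q) := by
    rw [Finset.mul_sum]
    symm
    refine Finset.sum_equiv (Units.mulLeft hiu.unit) (fun q => ?_) (fun q _ => ?_)
    · simp only [Finite.mem_toFinset, ball, mem_ofPred_eq, Units.mulLeft_apply,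
        IsUnit.unit_spec, hnorm]
    · simp only [Units.mulLeft_apply, IsUnit.unit_spec]
      rw [hlog, hchar]
      ring
  have h1 : (1 - Complex.I ^ n) * ∑ q ∈ (ball_finite x).toFinset,
      (primeLog q : ℂ) * angChar n (GaussianInt.toComplex q) = 0 := by linear_combination key
  exact (mul_eq_zero.1 h1).resolve_left (sub_ne_zero.2 (I_zpow_ne_one hn).symm)

/-- The Weyl sums over Gaussian primes. -/
theorem tendsto_sum_primeLog_mul_angChar (n : ℤ) :
    Tendsto (fun x : ℝ => (∑ q ∈ (ball_finite x).toFinset,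
      (primeLog q : ℂ) * angChar n (GaussianInt.toComplex q)) / x) atTop
      (𝓝 (if n = 0 then 4 else 0)) := by
  split_ifs with hn0
  · subst hn0
    have h1 := (Complex.continuous_ofReal.tendsto _).comp tendsto_sum_primeLog
    push_cast at h1
    refine h1.congr fun x => ?_
    simp only [Function.comp]
    push_cast
    congr 1
    refine Finset.sum_congr rfl fun q _ => ?_
    by_cases hq : Prime q
    · rw [angChar_zero_left (by simpa using hq.ne_zero), mul_one]
    · simp [primeLog_of_not_prime hq]
  by_cases hn : 4 ∣ n
  -- Subtracting the unweighted sum leaves `Re (c χ_n)`; the choices `c = 1` and `c = -I` recover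
  -- real and imaginary parts.
  · have key : ∀ c : ℂ, ‖c‖ ≤ 1 → Tendsto (fun x : ℝ => (∑ q ∈ (ball_finite x).toFinset,
        primeLog q * (c * angChar n (GaussianInt.toComplex q)).re) / x) atTop (𝓝 0) := by
      intro c hc
      have h1 := (tendsto_sum_primeLog_mul_one_add_re hn hn0 hc).sub tendsto_sum_primeLog
      rw [sub_self] at h1
      refine h1.congr fun x => ?_
      rw [← sub_div, ← Finset.sum_sub_distrib]
      congr 1
      refine Finset.sum_congr rfl fun q _ => by ring
    have hre := (Complex.continuous_ofReal.tendsto _).comp (key 1 (by simp))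
    have him := ((Complex.continuous_ofReal.tendsto _).comp
      (key (-Complex.I) (by simp))).mul_const Complex.I
    have := hre.add him
    simp only [Complex.ofReal_zero, zero_mul, add_zero] at this
    refine this.congr fun x => ?_
    simp only [Function.comp]
    push_cast
    rw [div_mul_eq_mul_div, ← add_div, Finset.sum_mul, ← Finset.sum_add_distrib]
    congr 1
    refine Finset.sum_congr rfl fun q _ => ?_
    have h2 : (-Complex.I * angChar n (GaussianInt.toComplex q)).re
        = (angChar n (GaussianInt.toComplex q)).im := by simp
    rw [h2, one_mul]
    conv_rhs => rw [← Complex.re_add_im (angChar n (GaussianInt.toComplex q))]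
    ring
  · simp_rw [sum_primeLog_mul_angChar_eq_zero hn, zero_div]
    exact tendsto_const_nhds

/-! ### Equidistribution on the circle -/

lemma integral_fourier_haarAddCircle {T : ℝ} [hT : Fact (0 < T)] (n : ℤ) :
    ∫ t : AddCircle T, fourier n t ∂AddCircle.haarAddCircle = if n = 0 then 1 else 0 := by
  have h := congrFun (fourierCoeff_fourier (T := T) n) 0
  rw [fourierCoeff, Pi.single_apply] at h
  simpa [eq_comm] using h

lemma integrable_circle {T : ℝ} [hT : Fact (0 < T)] (μ : FiniteMeasure (AddCircle T))
    (f : C(AddCircle T, ℂ)) : Integrable (fun t => f t) (μ : Measure (AddCircle T)) :=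
  f.continuous.integrable_of_hasCompactSupport (HasCompactSupport.of_compactSpace _)

lemma norm_integral_circle_le {T : ℝ} [hT : Fact (0 < T)] (μ : FiniteMeasure (AddCircle T))
    (f : C(AddCircle T, ℂ)) : ‖∫ t, f t ∂(μ : Measure (AddCircle T))‖ ≤ ‖f‖ * μ.mass := by
  have := norm_integral_le_of_norm_le_const (μ := (μ : Measure (AddCircle T))) (f := fun t => f t)
    (Eventually.of_forall fun t => f.norm_coe_le_norm t)
  exact this

/-- **Weyl's criterion**: convergence of all Fourier coefficients to those of Haar measure implies
weak convergence to Haar measure. -/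
theorem tendsto_haarAddCircle_of_tendsto_fourier {T : ℝ} [hT : Fact (0 < T)] {ι : Type*}
    {L : Filter ι} {μs : ι → FiniteMeasure (AddCircle T)}
    (h : ∀ n : ℤ, Tendsto (fun i => ∫ t, fourier n t ∂(μs i : Measure (AddCircle T))) L
      (𝓝 (if n = 0 then 1 else 0))) :
    Tendsto μs L (𝓝 ⟨AddCircle.haarAddCircle, inferInstance⟩) := by
  set μ : FiniteMeasure (AddCircle T) := ⟨AddCircle.haarAddCircle, inferInstance⟩ with hμ
  have hμ1 : (μ.mass : ℝ) = 1 := by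
    have : (AddCircle.haarAddCircle (T := T) univ).toNNReal = 1 := by simp
    exact_mod_cast this
  have hmass : Tendsto (fun i => ((μs i).mass : ℝ)) L (𝓝 1) := by
    have h0 := (Complex.continuous_re.tendsto _).comp (h 0)
    simp only [if_true, Complex.one_re] at h0
    refine h0.congr fun i => ?_
    simp only [Function.comp, fourier_zero, integral_const, Complex.real_smul, mul_one,
      Complex.ofReal_re]
    rfl
  have hall : ∀ f : C(AddCircle T, ℂ), Tendsto (fun i => ∫ t, f t ∂(μs i : Measure (AddCircle T))) L
      (𝓝 (∫ t, f t ∂(μ : Measure (AddCircle T)))) := by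
    have hspan : ∀ f ∈ Submodule.span ℂ (range (@fourier T)),
        Tendsto (fun i => ∫ t, f t ∂(μs i : Measure (AddCircle T))) L
          (𝓝 (∫ t, f t ∂(μ : Measure (AddCircle T)))) := by
      intro f hf
      induction hf using Submodule.span_induction with
      | mem f hf =>
        obtain ⟨n, rfl⟩ := hf
        have : ∫ t, fourier n t ∂(μ : Measure (AddCircle T)) = if n = 0 then 1 else 0 :=
          integral_fourier_haarAddCircle n
        rw [this]
        exact h n
      | zero => simpa using tendsto_const_nhds
      | add f g _ _ hf hg =>
        simp only [ContinuousMap.add_apply]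
        rw [integral_add (integrable_circle μ f) (integrable_circle μ g)]
        refine (hf.add hg).congr fun i => ?_
        rw [integral_add (integrable_circle _ f) (integrable_circle _ g)]
      | smul a f _ hf =>
        simp only [ContinuousMap.smul_apply, integral_smul]
        exact hf.const_smul a
    intro f
    rw [Metric.tendsto_nhds]
    intro ε hε
    have hf : f ∈ (Submodule.span ℂ (range (@fourier T))).topologicalClosure := by
      rw [span_fourier_closure_eq_top]; trivial
    -- The masses are eventually below 2, so replacing `f` by `g` costs `ε / 2` for `μs i` and `ε /
    -- 4` for Haar measure; the last `ε / 4` is the convergence for `g`.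
    obtain ⟨g, hg, hfg⟩ := Metric.mem_closure_iff.1 hf (ε / 4) (by positivity)
    rw [dist_eq_norm] at hfg
    have h1 := Metric.tendsto_nhds.1 (hspan g hg) (ε / 4) (by positivity)
    have h2 := hmass.eventually_lt_const (u := 2) one_lt_two
    filter_upwards [h1, h2] with i h1 h2
    rw [dist_eq_norm] at h1 ⊢
    have hsplit : ∀ ν : FiniteMeasure (AddCircle T), ∫ t, f t ∂(ν : Measure (AddCircle T))
        = ∫ t, (f - g) t ∂(ν : Measure (AddCircle T)) + ∫ t, g t ∂(ν : Measure (AddCircle T)) := by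
      intro ν
      rw [← integral_add (integrable_circle ν (f - g)) (integrable_circle ν g)]
      simp
    have e1 := norm_integral_circle_le (μs i) (f - g)
    have e2 := norm_integral_circle_le μ (f - g)
    rw [hμ1, mul_one] at e2
    have e3 : ‖f - g‖ * (μs i).mass ≤ ε / 4 * 2 :=
      mul_le_mul hfg.le h2.le (NNReal.coe_nonneg _) (by positivity)
    rw [hsplit (μs i), hsplit μ, add_sub_add_comm]
    refine (norm_add_le _ _).trans_lt ?_
    have e4 := norm_sub_le (∫ t, (f - g) t ∂(μs i : Measure (AddCircle T)))
      (∫ t, (f - g) t ∂(μ : Measure (AddCircle T)))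
    linarith
  rw [FiniteMeasure.tendsto_iff_forall_integral_tendsto]
  intro f
  have h1 := (Complex.continuous_re.tendsto _).comp
    (hall ⟨fun t => (f t : ℂ), Complex.continuous_ofReal.comp f.continuous⟩)
  have h2 : ∀ ν : FiniteMeasure (AddCircle T),
      (∫ t, ((f t : ℝ) : ℂ) ∂(ν : Measure (AddCircle T))).re
        = ∫ t, f t ∂(ν : Measure (AddCircle T)) := by
    intro ν
    rw [integral_complex_ofReal, Complex.ofReal_re]
  simp only [Function.comp_def, ContinuousMap.coe_mk, h2] at h1
  exact h1

/-- Weak convergence to Haar measure gives convergence on sets with null boundary. -/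
lemma tendsto_apply_of_tendsto_haarAddCircle {T : ℝ} [hT : Fact (0 < T)] {ι : Type*}
    {L : Filter ι} {μs : ι → FiniteMeasure (AddCircle T)}
    (h : Tendsto μs L (𝓝 ⟨AddCircle.haarAddCircle, inferInstance⟩)) {E : Set (AddCircle T)}
    (hE : AddCircle.haarAddCircle (frontier E) = 0) :
    Tendsto (fun i => (μs i : Measure (AddCircle T)).real E) L
      (𝓝 (AddCircle.haarAddCircle.real E)) := by
  set μ : FiniteMeasure (AddCircle T) := ⟨AddCircle.haarAddCircle, inferInstance⟩ with hμ
  have hμ1 : μ.mass = 1 := by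
    have : (AddCircle.haarAddCircle (T := T) univ).toNNReal = 1 := by simp
    exact this
  have hμ0 : μ ≠ 0 := by
    rw [← FiniteMeasure.mass_nonzero_iff, hμ1]; exact one_ne_zero
  -- The portmanteau theorem is applied to the normalised measures; multiplying back by the masses,
  -- which tend to 1, returns to the original ones.
  have hnorm : ∀ s, μ.normalize s = μ s := fun s => by
    rw [FiniteMeasure.self_eq_mass_mul_normalize μ s, hμ1, one_mul]
  have hE' : μ.normalize (frontier E) = 0 := by
    rw [hnorm, FiniteMeasure.null_iff_toMeasure_null]
    exact hE
  have h1 := ProbabilityMeasure.tendsto_measure_of_null_frontier_of_tendsto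
    (FiniteMeasure.tendsto_normalize_of_tendsto h hμ0) hE'
  have h2 := ((FiniteMeasure.continuous_mass.tendsto _).comp h).mul h1
  rw [hμ1, one_mul, hnorm] at h2
  have h3 := (NNReal.continuous_coe.tendsto _).comp h2
  refine h3.congr fun i => ?_
  simp only [Function.comp]
  rw [← FiniteMeasure.self_eq_mass_mul_normalize]
  rfl

instance : Fact (0 < 2 * Real.pi) := ⟨Real.two_pi_pos⟩

/-- The arc `[α, β)` on the circle `ℝ / 2πℤ`. -/
def arc (α β : ℝ) : Set (AddCircle (2 * Real.pi)) := (fun x : ℝ => (x : AddCircle _)) '' Ico α β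

lemma coe_mem_arc_iff {α β x : ℝ} (hα : 0 ≤ α) (hβ : β ≤ 2 * Real.pi)
    (hx : x ∈ Ico 0 (2 * Real.pi)) :
    (x : AddCircle (2 * Real.pi)) ∈ arc α β ↔ α ≤ x ∧ x < β := by
  constructor
  · rintro ⟨y, hy, hyx⟩
    have : y = x := (AddCircle.coe_eq_coe_iff_of_mem_Ico (a := 0) (p := 2 * Real.pi)
      ⟨hα.trans hy.1, by linarith [hy.2]⟩ (by simpa using hx)).1 hyx
    exact this ▸ hy
  · intro h
    exact ⟨x, h, rfl⟩

lemma haarAddCircle_singleton (z : AddCircle (2 * Real.pi)) :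
    AddCircle.haarAddCircle {z} = 0 := by
  have h : (volume : Measure (AddCircle (2 * Real.pi))) {z} = 0 := by
    rw [← Metric.closedBall_zero, AddCircle.volume_closedBall]
    simp [Real.pi_pos.le]
  rw [AddCircle.volume_eq_smul_haarAddCircle, Measure.smul_apply, smul_eq_mul, mul_eq_zero] at h
  exact h.resolve_left (by simpa using Real.pi_pos)

/-- The quotient map is continuous and open, so the frontier of the arc lies in the images of the
two endpoints. -/
lemma haarAddCircle_frontier_arc (α β : ℝ) :
    AddCircle.haarAddCircle (frontier (arc α β)) = 0 := by
  refine measure_mono_null (t := {(α : AddCircle (2 * Real.pi)), (β : AddCircle (2 * Real.pi))}) ?_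
    ?_
  swap
  · rw [← union_singleton]
    exact measure_union_null (haarAddCircle_singleton _) (haarAddCircle_singleton _)
  have hclosed : closure (arc α β) ⊆ (fun x : ℝ => (x : AddCircle (2 * Real.pi))) '' Icc α β :=
    closure_minimal (image_mono Ico_subset_Icc_self)
      (isCompact_Icc.image (AddCircle.continuous_mk' _)).isClosed
  have hopen : (fun x : ℝ => (x : AddCircle (2 * Real.pi))) '' Ioo α β ⊆ interior (arc α β) :=
    interior_maximal (image_mono Ioo_subset_Ico_self)
      (QuotientAddGroup.isOpenMap_coe _ isOpen_Ioo)
  rintro z ⟨hz1, hz2⟩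
  obtain ⟨x, hx, rfl⟩ := hclosed hz1
  rcases hx.1.eq_or_lt with h1 | h1
  · exact Or.inl (by rw [h1])
  rcases hx.2.eq_or_lt with h2 | h2
  · exact Or.inr (by rw [← h2]; rfl)
  exact absurd (hopen ⟨x, ⟨h1, h2⟩, rfl⟩) hz2

lemma measurableSet_arc (α β : ℝ) : MeasurableSet (arc α β) := by
  rcases le_or_gt β α with h | h
  · simp [arc, Ico_eq_empty_of_le h]
  · rw [arc, ← Ioo_union_left h, image_union, image_singleton]
    exact (QuotientAddGroup.isOpenMap_coe _ isOpen_Ioo).measurableSet.union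
      (measurableSet_singleton _)

lemma haarAddCircle_arc {α β : ℝ} (hα : 0 ≤ α) (hαβ : α ≤ β) (hβ : β ≤ 2 * Real.pi) :
    AddCircle.haarAddCircle.real (arc α β) = (β - α) / (2 * Real.pi) := by
  have hvol : (volume : Measure (AddCircle (2 * Real.pi))).real (arc α β) = β - α := by
    rw [Measure.real, ← (AddCircle.measurePreserving_mk (2 * Real.pi) 0).measure_preimage
      (measurableSet_arc α β).nullMeasurableSet, ← restrict_Ioo_eq_restrict_Ioc,
      Measure.restrict_apply' measurableSet_Ioo]
    have h1 : (QuotientAddGroup.mk ⁻¹' arc α β ∩ Ioo 0 (0 + 2 * Real.pi) : Set ℝ)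
        = Ico α β ∩ Ioo 0 (2 * Real.pi) := by
      rw [zero_add]
      ext x
      refine and_congr_left fun hx => ?_
      exact coe_mem_arc_iff hα hβ ⟨hx.1.le, hx.2⟩
    -- For `α = 0` the left endpoint is lost in the open fundamental interval, hence equality only
    -- almost everywhere.
    have h2 : (Ico α β ∩ Ioo 0 (2 * Real.pi) : Set ℝ) =ᵐ[volume] (Ioo α β : Set ℝ) := by
      have h3 : (Ico α β ∩ Ioo 0 (2 * Real.pi) : Set ℝ)
          =ᵐ[volume] (Ioo α β ∩ Ioo 0 (2 * Real.pi) : Set ℝ) :=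
        Ioo_ae_eq_Ico.symm.inter (ae_eq_refl _)
      rwa [inter_eq_self_of_subset_left (Ioo_subset_Ioo hα hβ)] at h3
    rw [h1, measure_congr h2, Real.volume_Ioo, ENNReal.toReal_ofReal (by linarith)]
  rw [AddCircle.volume_eq_smul_haarAddCircle, measureReal_ennreal_smul_apply,
    ENNReal.toReal_ofReal Real.two_pi_pos.le] at hvol
  rw [eq_div_iff Real.two_pi_pos.ne', mul_comm]
  exact hvol

/-! ### Gaussian primes in sectors -/

/-- The distribution of the arguments of the Gaussian primes of norm at most `x`, with logarithmic
weights. -/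
def argMeasure (x : ℝ) : FiniteMeasure (AddCircle (2 * Real.pi)) :=
  ∑ q ∈ (ball_finite x).toFinset, (primeLog q / (4 * x)).toNNReal •
    (diracProba (arg q : AddCircle (2 * Real.pi))).toFiniteMeasure

lemma integral_argMeasure {E : Type*} [NormedAddCommGroup E] [NormedSpace ℝ E] [CompleteSpace E]
    (f : AddCircle (2 * Real.pi) → E) {x : ℝ} (hx : 0 < x) :
    ∫ t, f t ∂(argMeasure x : Measure (AddCircle (2 * Real.pi)))
      = ∑ q ∈ (ball_finite x).toFinset, (primeLog q / (4 * x)) • f (arg q) := by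
  rw [argMeasure, FiniteMeasure.toMeasure_sum, integral_finsetSum_measure]
  · refine Finset.sum_congr rfl fun q _ => ?_
    rw [FiniteMeasure.toMeasure_smul, integral_smul_nnreal_measure]
    change (primeLog q / (4 * x)).toNNReal • ∫ t, f t ∂(Measure.dirac _) = _
    rw [integral_dirac, NNReal.smul_def, Real.coe_toNNReal _
      (div_nonneg (primeLog_nonneg q) (by positivity))]
  · intro q _
    rw [FiniteMeasure.toMeasure_smul]
    refine Integrable.smul_measure_nnreal ?_
    exact integrable_dirac (by finiteness)

/-- This identifies the Fourier coefficients of `argMeasure` with the Weyl sums; shifting the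
argument by `2π` is invisible on the circle. -/
lemma fourier_arg {q : GaussianInt} (hq : q ≠ 0) (n : ℤ) :
    fourier n (arg q : AddCircle (2 * Real.pi)) = angChar n (GaussianInt.toComplex q) := by
  have hz : GaussianInt.toComplex q ≠ 0 := by simpa using hq
  set z := GaussianInt.toComplex q with hzdef
  have h1 : (arg q : AddCircle (2 * Real.pi)) = ((Complex.arg z : ℝ) : AddCircle (2 * Real.pi)) :=
    Real.Angle.coe_toIcoMod _ _
  have hnz : (‖z‖ : ℂ) ≠ 0 := by exact_mod_cast (norm_pos_iff.2 hz).ne'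
  have h2 : z / ‖z‖ = Complex.exp (Complex.arg z * Complex.I) := by
    rw [div_eq_iff hnz, mul_comm, Complex.norm_mul_exp_arg_mul_I]
  rw [h1, fourier_coe_apply, angChar_of_ne hz, h2, ← Complex.exp_int_mul]
  congr 1
  have : (Real.pi : ℂ) ≠ 0 := by exact_mod_cast Real.pi_ne_zero
  push_cast
  field_simp

lemma tendsto_argMeasure :
    Tendsto argMeasure atTop (𝓝 ⟨AddCircle.haarAddCircle, inferInstance⟩) := by
  refine tendsto_haarAddCircle_of_tendsto_fourier fun n => ?_
  have h1 := (tendsto_sum_primeLog_mul_angChar n).div_const 4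
  have h2 : (if n = 0 then (4 : ℂ) else 0) / 4 = if n = 0 then 1 else 0 := by
    split_ifs <;> simp
  rw [h2] at h1
  refine h1.congr' ?_
  filter_upwards [eventually_gt_atTop 0] with x hx
  rw [integral_argMeasure _ hx, div_div, Finset.sum_div]
  refine Finset.sum_congr rfl fun q _ => ?_
  by_cases hq : Prime q
  · rw [fourier_arg hq.ne_zero, Complex.real_smul]
    push_cast
    ring
  · simp [primeLog_of_not_prime hq]

lemma arg_mem_Ico (q : GaussianInt) : arg q ∈ Ico 0 (2 * Real.pi) := by
  have h := toIcoMod_mem_Ico Real.two_pi_pos 0 (Complex.arg (GaussianInt.toComplex q))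
  rw [zero_add] at h
  exact h

/-- The prime number theorem for Gaussian primes in sectors, in Chebyshev form. -/
theorem tendsto_sum_primeLog_sector {α β : ℝ} (hα : 0 ≤ α) (hαβ : α ≤ β) (hβ : β ≤ 2 * Real.pi) :
    Tendsto (fun x => (∑ q ∈ (ball_finite x).toFinset,
      indicator {q | α ≤ arg q ∧ arg q < β} primeLog q) / x) atTop
      (𝓝 (2 / Real.pi * (β - α))) := by
  have h1 := (tendsto_apply_of_tendsto_haarAddCircle tendsto_argMeasure
    (haarAddCircle_frontier_arc α β)).const_mul 4
  rw [haarAddCircle_arc hα hαβ hβ] at h1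
  have h2 : 4 * ((β - α) / (2 * Real.pi)) = 2 / Real.pi * (β - α) := by
    have := Real.pi_ne_zero
    field_simp
    ring
  rw [h2] at h1
  refine h1.congr' ?_
  filter_upwards [eventually_gt_atTop 0] with x hx
  rw [← integral_indicator_one (measurableSet_arc α β), integral_argMeasure _ hx, Finset.mul_sum,
    Finset.sum_div]
  refine Finset.sum_congr rfl fun q _ => ?_
  have hiff := coe_mem_arc_iff hα hβ (arg_mem_Ico q)
  by_cases hq : α ≤ arg q ∧ arg q < β
  · rw [indicator_of_mem (hiff.2 hq), indicator_of_mem (show q ∈ {q : GaussianInt | α ≤ arg q ∧ arg q < β} from hq)]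
    simp only [Pi.one_apply, smul_eq_mul]
    field_simp
  · rw [indicator_of_notMem (fun h => hq (hiff.1 h)),
      indicator_of_notMem (show q ∉ {q : GaussianInt | α ≤ arg q ∧ arg q < β} from hq)]
    simp

/-! ### From logarithmic weights to counting -/

/-- The lattice count for `n = 0` with `R = √x`; the trivial character vanishes at 0, hence the
shift by one. -/
lemma card_ball_le : ∃ C : ℝ, 0 ≤ C ∧ ∀ x : ℝ, 1 ≤ x →
    ((ball_finite x).toFinset.card : ℝ) ≤ C * x := by
  obtain ⟨C, hC⟩ := norm_sum_angChar_sub_le 0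
  refine ⟨|C| + Real.pi + 1, by positivity, fun x hx => ?_⟩
  have hx0 : 0 ≤ x := by linarith
  have h1 := hC (√x) (Real.one_le_sqrt.2 hx)
  simp only [Real.sq_sqrt hx0, if_true] at h1
  set s := (ball_finite x).toFinset with hs
  have h0 : (0 : GaussianInt) ∈ s := by
    rw [hs, Set.Finite.mem_toFinset]
    simpa [ball] using hx0
  have h2 : ∑ ω ∈ s, angChar 0 (GaussianInt.toComplex ω) = (s.card : ℂ) - 1 := by
    rw [← Finset.sum_erase_add _ _ h0, map_zero, angChar_zero, add_zero,
      Finset.sum_congr rfl (g := fun _ => 1) fun ω hω => ?_]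
    · rw [Finset.sum_const, Finset.card_erase_of_mem h0, nsmul_one,
        Nat.cast_sub (Finset.card_pos.2 ⟨0, h0⟩), Nat.cast_one]
    · exact angChar_zero_left (by simpa using Finset.ne_of_mem_erase hω)
  rw [h2] at h1
  have h3 := (Complex.abs_re_le_norm _).trans h1
  have h4 : ((s.card : ℂ) - 1 - ((Real.pi * x : ℝ) : ℂ)).re = s.card - 1 - Real.pi * x := by
    simp
  rw [h4] at h3
  have h5 := (abs_le.1 h3).2
  have h6 : √x * √(√x) ≤ x := by
    have h7 : √(√x) ≤ √x := by
      rw [Real.sqrt_le_left (Real.sqrt_nonneg x)]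
      nlinarith [Real.one_le_sqrt.2 hx]
    calc √x * √(√x) ≤ √x * √x := mul_le_mul_of_nonneg_left h7 (Real.sqrt_nonneg x)
      _ = x := Real.mul_self_sqrt hx0
  have h8 : C * (√x * √(√x)) ≤ |C| * x :=
    mul_le_mul (le_abs_self C) h6 (by positivity) (abs_nonneg C)
  linarith

/-- Removing the logarithmic weights by partial summation. -/
theorem tendsto_card_mul_log_div {P : Set GaussianInt} {c : ℝ}
    (h : Tendsto (fun x => (∑ q ∈ (ball_finite x).toFinset, indicator P primeLog q) / x)
      atTop (𝓝 c)) :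
    Tendsto (fun x => ((primes ∩ ball x ∩ P).ncard : ℝ) * Real.log x / x) atTop (𝓝 c) := by
  classical
  set W : ℝ → ℝ := fun x => ∑ q ∈ (ball_finite x).toFinset, indicator P primeLog q with hW
  set K : ℝ → ℝ := fun x => ((primes ∩ ball x ∩ P).ncard : ℝ) with hK
  have hKeq : ∀ x, K x
      = (((ball_finite x).toFinset.filter fun q => Prime q ∧ q ∈ P).card : ℝ) := by
    intro x
    simp only [hK]
    rw [← Set.ncard_coe_finset]
    congr 2
    ext q
    simp only [primes, mem_inter_iff, mem_ofPred_eq, Finset.coe_filter, Finite.mem_toFinset]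
    tauto
  have hWeq : ∀ x, W x = ∑ q ∈ (ball_finite x).toFinset.filter (fun q => Prime q ∧ q ∈ P),
      logNorm q := by
    intro x
    simp only [hW]
    rw [Finset.sum_filter]
    refine Finset.sum_congr rfl fun q _ => ?_
    by_cases hq : Prime q <;> by_cases hP : q ∈ P <;>
      simp [hq, hP, primeLog_of_prime, primeLog_of_not_prime]
  have hlow : ∀ x, 1 ≤ x → W x ≤ K x * Real.log x := by
    intro x hx
    rw [hWeq, hKeq, ← nsmul_eq_mul]
    refine Finset.sum_le_card_nsmul _ _ _ fun q hq => ?_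
    obtain ⟨h1, h2, -⟩ := Finset.mem_filter.1 hq
    refine Real.log_le_log (by linarith [one_le_norm h2.ne_zero]) ?_
    exact (Set.Finite.mem_toFinset (ball_finite x)).1 h1
  obtain ⟨C, hC0, hC⟩ := card_ball_le
  -- Split at norm `x ^ (1 - δ)`: below it even all Gaussian integers are too few to matter, above
  -- it each prime has weight at least `(1 - δ) log x`.
  have hup : ∀ δ : ℝ, 0 < δ → δ < 1 → ∀ x, 1 ≤ x →
      K x * Real.log x ≤ W x / (1 - δ) + C * x ^ (1 - δ) * Real.log x := by
    intro δ hδ hδ1 x hx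
    have hx0 : 0 < x := by linarith
    have hlog : 0 ≤ Real.log x := Real.log_nonneg hx
    set S := (ball_finite x).toFinset.filter fun q => Prime q ∧ q ∈ P with hS
    set y := x ^ (1 - δ) with hy
    have hy1 : 1 ≤ y := Real.one_le_rpow hx (by linarith)
    have hsplit := Finset.card_filter_add_card_filter_not (s := S)
      (fun q => ((Zsqrtd.norm q : ℤ) : ℝ) ≤ y)
    have hsmall : ((S.filter fun q => ((Zsqrtd.norm q : ℤ) : ℝ) ≤ y).card : ℝ) ≤ C * y := by
      refine le_trans ?_ (hC y hy1)
      refine Nat.cast_le.2 (Finset.card_le_card fun q hq => ?_)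
      rw [Set.Finite.mem_toFinset]
      exact (Finset.mem_filter.1 hq).2
    have hlarge : ((S.filter fun q => ¬ ((Zsqrtd.norm q : ℤ) : ℝ) ≤ y).card : ℝ)
        * ((1 - δ) * Real.log x) ≤ W x := by
      rw [hWeq, ← nsmul_eq_mul]
      refine (Finset.card_nsmul_le_sum _ logNorm _ fun q hq => ?_).trans
        (Finset.sum_le_sum_of_subset_of_nonneg (Finset.filter_subset _ _)
          fun q _ _ => logNorm_nonneg q)
      have h1 := (Finset.mem_filter.1 hq).2
      push Not at h1
      rw [← Real.log_rpow hx0]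
      exact Real.log_le_log (by linarith) h1.le
    have hKx : K x = (S.filter fun q => ((Zsqrtd.norm q : ℤ) : ℝ) ≤ y).card
        + (S.filter fun q => ¬ ((Zsqrtd.norm q : ℤ) : ℝ) ≤ y).card := by
      rw [← Nat.cast_add, hsplit, hKeq]
    have hd : 0 < 1 - δ := by linarith
    have h1 : ((S.filter fun q => ¬ ((Zsqrtd.norm q : ℤ) : ℝ) ≤ y).card : ℝ) * Real.log x
        ≤ W x / (1 - δ) := by
      rw [le_div_iff₀ hd]; linarith
    have h2 := mul_le_mul_of_nonneg_right hsmall hlog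
    rw [hKx]
    linarith
  refine tendsto_order.2 ⟨fun a ha => ?_, fun b hb => ?_⟩
  · filter_upwards [h.eventually_const_lt ha, eventually_ge_atTop 1] with x h1 hx
    exact h1.trans_le (div_le_div_of_nonneg_right (hlow x hx) (by linarith))
  · obtain ⟨δ, hδ, hδ0, hδ1⟩ : ∃ δ : ℝ, c / (1 - δ) < b ∧ 0 < δ ∧ δ < 1 := by
      have hcont : ContinuousAt (fun δ : ℝ => c / (1 - δ)) 0 :=
        ContinuousAt.div (by fun_prop) (by fun_prop) (by norm_num)
      have h1 : ∀ᶠ δ in 𝓝[>] (0 : ℝ), c / (1 - δ) < b :=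
        (hcont.tendsto.mono_left nhdsWithin_le_nhds).eventually_lt_const (by simpa using hb)
      obtain ⟨δ, h2, h3⟩ := (h1.and (Ioo_mem_nhdsGT one_pos)).exists
      exact ⟨δ, h2, h3.1, h3.2⟩
    have hlogpow : Tendsto (fun x : ℝ => Real.log x / x ^ δ) atTop (𝓝 0) :=
      (isLittleO_log_rpow_atTop hδ0).tendsto_div_nhds_zero
    have hlim := (h.div_const (1 - δ)).add (hlogpow.const_mul C)
    rw [mul_zero, add_zero] at hlim
    filter_upwards [hlim.eventually_lt_const hδ, eventually_ge_atTop 1] with x h1 hx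
    have hx0 : 0 < x := by linarith
    refine (div_le_div_of_nonneg_right (hup δ hδ0 hδ1 x hx) hx0.le).trans_lt (lt_of_eq_of_lt ?_ h1)
    rw [Real.rpow_sub hx0, Real.rpow_one, add_div]
    congr 1
    · exact div_right_comm _ _ _
    · have := (Real.rpow_pos_of_pos hx0 δ).ne'
      field_simp

/-- The prime number theorem for Gaussian primes in sectors. -/
theorem sectorPrimeCount_isEquivalent {α β : ℝ} (hα : 0 ≤ α) (hαβ : α < β)
    (hβ : β ≤ 2 * Real.pi) :
    Asymptotics.IsEquivalent atTop (fun x : ℝ => (sectorPrimeCount α β x : ℝ))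
      (fun x : ℝ => 2 / Real.pi * (β - α) * (x / Real.log x)) := by
  have hc : 0 < 2 / Real.pi * (β - α) := mul_pos (by positivity) (by linarith)
  have h1 := tendsto_card_mul_log_div (tendsto_sum_primeLog_sector hα hαβ.le hβ)
  rw [Asymptotics.isEquivalent_iff_tendsto_one]
  · have h2 := h1.div_const (2 / Real.pi * (β - α))
    rw [div_self hc.ne'] at h2
    refine h2.congr' ?_
    filter_upwards [eventually_gt_atTop 1] with x hx
    have hlog := Real.log_pos hx
    have hcount : sectorPrimeCount α β x
      = (primes ∩ ball x ∩ {q | α ≤ arg q ∧ arg q < β}).ncard := rfl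
    rw [Pi.div_apply, hcount]
    field_simp
  · filter_upwards [eventually_gt_atTop 1] with x hx
    have hlog := Real.log_pos hx
    have hx0 : 0 < x := by linarith
    positivity

/-! ### Representatives in the first quadrant -/

lemma arg_lt_pi_div_two_iff {ω : GaussianInt} (hω : ω ≠ 0) :
    0 ≤ arg ω ∧ arg ω < Real.pi / 2 ↔ 0 < ω.re ∧ 0 ≤ ω.im := by
  have hpi := Real.pi_pos
  set z := GaussianInt.toComplex ω with hz
  have hz0 : z ≠ 0 := by simpa [hz] using hω
  have hre : 0 < ω.re ↔ 0 < z.re := by rw [hz, ← GaussianInt.intCast_re]; exact Int.cast_pos.symm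
  have him : 0 ≤ ω.im ↔ 0 ≤ z.im := by
    rw [hz, ← GaussianInt.intCast_im]; exact Int.cast_nonneg_iff.symm
  have hle := Complex.arg_le_pi z
  have hlt := Complex.neg_pi_lt_arg z
  have h0 := (arg_mem_Ico ω).1
  rw [hre, him, ← Complex.arg_nonneg_iff]
  have hre' : 0 < z.re ↔ |Complex.arg z| < Real.pi / 2 := by
    rw [Complex.abs_arg_lt_pi_div_two_iff, or_iff_left hz0]
  rw [hre']
  rcases le_or_gt 0 (Complex.arg z) with h | h
  · have : arg ω = Complex.arg z :=
      (toIcoMod_eq_self Real.two_pi_pos).2 ⟨h, by linarith⟩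
    rw [this, abs_of_nonneg h]
    tauto
  -- A negative principal argument is moved by `2π` to a value above `π`, so neither side of the
  -- equivalence can hold.
  · have : arg ω = Complex.arg z + 2 * Real.pi := by
      have h1 : toIcoMod Real.two_pi_pos 0 (Complex.arg z + 2 * Real.pi)
          = Complex.arg z + 2 * Real.pi :=
        (toIcoMod_eq_self Real.two_pi_pos).2 ⟨by linarith, by linarith⟩
      rw [toIcoMod_add_right] at h1
      exact h1
    rw [this]
    constructor
    · rintro ⟨-, h2⟩; linarith
    · rintro ⟨-, h2⟩; linarith

lemma exists_associated_first_quadrant {ω : GaussianInt} (hω : ω ≠ 0) :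
    ∃ η, Associated ω η ∧ 0 < η.re ∧ 0 ≤ η.im := by
  obtain ⟨a, b⟩ := ω
  have hab : a ≠ 0 ∨ b ≠ 0 := by
    by_contra! h
    exact hω (Zsqrtd.ext h.1 h.2)
  have key : ∀ u ∈ gaussUnits, Associated (⟨a, b⟩ : GaussianInt) (u * ⟨a, b⟩) := fun u hu =>
    (associated_unit_mul_left _ u (mem_gaussUnits_iff.1 hu)).symm
  -- The four half-open quadrants; the units `1`, `-1`, `-i`, `i`, in this order, rotate them to the
  -- first.
  have hcases : (0 < a ∧ 0 ≤ b) ∨ (a < 0 ∧ b ≤ 0) ∨ (a ≤ 0 ∧ 0 < b) ∨ (0 ≤ a ∧ b < 0) := by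
    omega
  rcases hcases with h | h | h | h
  · exact ⟨_, key 1 (by decide), by simpa using h⟩
  · exact ⟨_, key (-1) (by decide), by simpa using h⟩
  · exact ⟨_, key ⟨0, -1⟩ (by decide), by simpa [Zsqrtd.re_mul, Zsqrtd.im_mul] using h.symm⟩
  · exact ⟨_, key ⟨0, 1⟩ (by decide), by simpa [Zsqrtd.re_mul, Zsqrtd.im_mul] using h.symm⟩

lemma eq_of_associated_first_quadrant {ω η : GaussianInt} (h : Associated ω η)
    (hω : 0 < ω.re ∧ 0 ≤ ω.im) (hη : 0 < η.re ∧ 0 ≤ η.im) : ω = η := by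
  obtain ⟨u, rfl⟩ := h
  have hu := mem_gaussUnits_iff.2 u.isUnit
  simp only [gaussUnits, Finset.mem_insert, Finset.mem_singleton] at hu
  rcases hu with hu | hu | hu | hu <;> rw [hu] at hη ⊢ <;>
    simp [Zsqrtd.re_mul, Zsqrtd.im_mul] at hη ⊢ <;> omega

/-- Every class of associated primes has exactly one representative in the first quadrant. -/
theorem primeCount_eq_ncard (x : ℝ) : primeCount x = (primesPlus ∩ ball x).ncard := by
  have himage : Associates.mk '' (primes ∩ ball x) = Associates.mk '' (primesPlus ∩ ball x) := by
    refine Subset.antisymm ?_ (image_mono (inter_subset_inter_left _ fun p hp => hp.1))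
    rintro _ ⟨p, ⟨hp, hpx⟩, rfl⟩
    have hp' : Prime p := hp
    obtain ⟨η, hη, hq⟩ := exists_associated_first_quadrant hp'.ne_zero
    have hηp : Prime η := hη.prime_iff.1 hp'
    refine ⟨η, ⟨⟨hηp, (arg_lt_pi_div_two_iff hηp.ne_zero).2 hq⟩, ?_⟩,
      (Associates.mk_eq_mk_iff_associated.2 hη).symm⟩
    obtain ⟨u, rfl⟩ := hη
    change ((Zsqrtd.norm (p * (u : GaussianInt)) : ℤ) : ℝ) ≤ x
    rw [Zsqrtd.norm_mul, (norm_eq_one_iff_isUnit _).2 u.isUnit, mul_one]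
    exact hpx
  rw [primeCount, himage]
  refine Set.InjOn.ncard_image ?_
  rintro p ⟨⟨hp, hp1⟩, -⟩ q ⟨⟨hq, hq1⟩, -⟩ hpq
  have hp' : Prime p := hp
  have hq' : Prime q := hq
  exact eq_of_associated_first_quadrant (Associates.mk_eq_mk_iff_associated.1 hpq)
    ((arg_lt_pi_div_two_iff hp'.ne_zero).1 hp1) ((arg_lt_pi_div_two_iff hq'.ne_zero).1 hq1)

lemma primeCount_eq_sectorPrimeCount (x : ℝ) :
    primeCount x = sectorPrimeCount 0 (Real.pi / 2) x := by
  rw [primeCount_eq_ncard, sectorPrimeCount]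
  congr 1
  ext p
  simp only [primesPlus, mem_inter_iff, mem_ofPred_eq]
  tauto

end HeckePNT

end

/-- Part (a) is the sector `[0, π/2)` of part (b), where the constant is `(2 / π) (π / 2) = 1`. -/
theorem theorem5p25 :
    ((∀ x : ℝ, GaussianPNT.primeCount x = (GaussianPNT.primesPlus ∩ GaussianPNT.ball x).ncard) ∧
      Asymptotics.IsEquivalent Filter.atTop
        (fun x : ℝ => (GaussianPNT.primeCount x : ℝ))
        (fun x : ℝ => x / Real.log x)) ∧
    (∀ α β : ℝ, 0 ≤ α → α < β → β ≤ 2 * Real.pi →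
      Asymptotics.IsEquivalent Filter.atTop
        (fun x : ℝ => (GaussianPNT.sectorPrimeCount α β x : ℝ))
        (fun x : ℝ => 2 / Real.pi * (β - α) * (x / Real.log x))) := by
  refine ⟨⟨HeckePNT.primeCount_eq_ncard, ?_⟩,
    fun α β hα hαβ hβ => HeckePNT.sectorPrimeCount_isEquivalent hα hαβ hβ⟩
  have hpi := Real.pi_pos
  have h := HeckePNT.sectorPrimeCount_isEquivalent (α := 0) (β := Real.pi / 2) le_rfl
    (by linarith) (by linarith)
  have h1 : 2 / Real.pi * (Real.pi / 2 - 0) = 1 := by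
    field_simp
    norm_num
  simp only [h1, one_mul, ← HeckePNT.primeCount_eq_sectorPrimeCount] at h
  exact h
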